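/- Let $d,k\ge 1$ be integers and $\mu\in\mathbb{R}^d$, and let $G\sim N(\mu,\mathbb{I}_d)$. For $\alpha\in(0,\tfrac12]$ and $\tau\in(0,1)$ put $L:=\log\big(\tfrac{dk}{\alpha}\log\tfrac1\tau\big)$. A function $p:\mathbb{R}^d\to\mathbb{R}$ is called a *$k^2$-sparse polynomial* if either (1) $p(x)=v\cdot x$ for some $v\in\mathbb{R}^d$ with at most $k^2$ nonzero entries, or (2) $p=h_A$ for some symmetric matrix $A\in\mathbb{R}^{d\times d}$ with at most $k^2$ nonzero entries, where $$\sqrt{2}\,h_A(x)=\sum_{i_1,i_2=1}^d A_{i_1,i_2}\prod_{j=1}^d \mathrm{He}_{c_j(i_1,i_2)}(x_j),$$ $c_j(i_1,i_2)$ is the number of times $j$ occurs in $(i_1,i_2)$, and $\mathrm{He}_a(t)=(-1)^a e^{t^2/2}\frac{d^a}{dt^a}e^{-t^2/2}$. A finite sample $S=(x_1,\dots,x_N)$ in $\mathbb{R}^d$ is called *representative* (with respect to $G$, $k$, $\alpha$, $\tau$) if for every $k^2$-sparse polynomial $p$ $$\Big|\Pr[p(G)\ge 0]-\Pr[p(S)\ge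 0]\Big|\le\frac{\alpha^3}{100\,k^4\,L^2},$$ where $\Pr[p(S)\ge0]=\frac1N\,|\{i: p(x_i)\ge 0\}|$. **Proposition (Sample complexity).** There is a universal constant $C>0$ such that the following holds for all integers $d,k\ge1$, all $\mu\in\mathbb{R}^d$, all $\alpha\in(0,\tfrac12]$ and all $\tau\in(0,1)$ with $\tau\le d/2$ (which is automatic for $d\ge2$) and $\tfrac{dk}{\alpha}\log\tfrac1\tau\ne1$ (so that $L\neq0$). If $$N\ \ge\ C\,\alpha^{-6}k^{12}\,\log\!\Big(\frac d\tau\Big)\,\log^4\!\Big(\frac{dk}{\alpha}\log\frac1\tau\Big),$$ then $N$ independent samples from $N(\mu,\mathbb{I}_d)$ form a representative sample with probability at least $1-\tau$. -/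

import Mathlib

open MeasureTheory ProbabilityTheory

noncomputable section

namespace SparsePoly

/-- The law of `G`, i.e. the Gaussian distribution `N(μ, I_d)` on `ℝ^d`. -/
def gaussianId {d : ℕ} (μ : EuclideanSpace ℝ (Fin d)) : Measure (EuclideanSpace ℝ (Fin d)) :=
  multivariateGaussian μ (1 : Matrix (Fin d) (Fin d) ℝ)

/-- The number of times `j` occurs in the multi-index `(i_1, …, i_l)`. -/
def multiplicity {d l : ℕ} (I : Fin l → Fin d) (j : Fin d) : ℕ :=
  (Finset.univ.filter fun t => I t = j).card

/-- The harmonic polynomial `h_A` of an order-`l` tensor `A`: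
`√(l!) · h_A(x) = ∑_{i_1,…,i_l} A_{i_1,…,i_l} ∏_j He_{c_j(i_1,…,i_l)}(x_j)`,
with `He_a` the probabilists' Hermite polynomials. -/
def harmonicPoly {d l : ℕ} (A : (Fin l → Fin d) → ℝ) (x : EuclideanSpace ℝ (Fin d)) : ℝ :=
  (Real.sqrt (l.factorial : ℝ))⁻¹ *
    ∑ I : Fin l → Fin d, A I *
      ∏ j : Fin d, Polynomial.aeval (x j) (Polynomial.hermite (multiplicity I j))

/-- `k²`-sparse linear polynomials: `p(x) = v · x` where `v` has at most `k²` nonzero entries. -/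
def IsSparseLinear {d : ℕ} (k : ℕ) (p : EuclideanSpace ℝ (Fin d) → ℝ) : Prop :=
  ∃ v : EuclideanSpace ℝ (Fin d), {i | v i ≠ 0}.ncard ≤ k ^ 2 ∧ ∀ x, p x = ∑ i, v i * x i

/-- `k²`-sparse harmonic quadratic polynomials: `p = h_A` for a symmetric `d × d` matrix `A`
with at most `k²` nonzero entries. -/
def IsSparseHarmonicQuadratic {d : ℕ} (k : ℕ) (p : EuclideanSpace ℝ (Fin d) → ℝ) : Prop :=
  ∃ A : Matrix (Fin d) (Fin d) ℝ, A.IsSymm ∧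
    {ij : Fin d × Fin d | A ij.1 ij.2 ≠ 0}.ncard ≤ k ^ 2 ∧
    ∀ x, p x = harmonicPoly (l := 2) (fun I => A (I 0) (I 1)) x

/-- A `k²`-sparse polynomial is a sparse linear or a sparse harmonic quadratic polynomial. -/
def IsSparsePoly {d : ℕ} (k : ℕ) (p : EuclideanSpace ℝ (Fin d) → ℝ) : Prop :=
  IsSparseLinear k p ∨ IsSparseHarmonicQuadratic k p

/-- `Pr[p(S) ≥ 0]` for a uniformly random element of the sample `S = {x_1, …, x_N}`
(counted with multiplicity): the fraction of the `i` with `p(x_i) ≥ 0`. -/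
def empiricalProb {d N : ℕ} (S : Fin N → EuclideanSpace ℝ (Fin d))
    (p : EuclideanSpace ℝ (Fin d) → ℝ) : ℝ :=
  ({i | 0 ≤ p (S i)}.ncard : ℝ) / N

/-- The logarithmic factor `log((dk/α) log(1/τ))`. -/
def logFactor (d k : ℕ) (α τ : ℝ) : ℝ :=
  Real.log ((d : ℝ) * k / α * Real.log (1 / τ))

/-- The sample `S` is representative with respect to `G ∼ N(μ, I_d)`. -/
def IsRepresentative {d N : ℕ} (k : ℕ) (α τ : ℝ) (μ : EuclideanSpace ℝ (Fin d))
    (S : Fin N → EuclideanSpace ℝ (Fin d)) : Prop :=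
  ∀ p : EuclideanSpace ℝ (Fin d) → ℝ, IsSparsePoly k p →
    |(gaussianId μ).real {x | 0 ≤ p x} - empiricalProb S p| ≤
      α ^ 3 / (100 * (k : ℝ) ^ 4 * logFactor d k α τ ^ 2)

end SparsePoly

end

/-! After translation by `μ`, every event `p ≥ 0` becomes `q ≥ 0` for a standard Gaussian point `z`.
Here `q` is a quadratic form in the homogeneous coordinates `(1, z)` with at most `M = 4k²` nonzero
coefficients. Representativeness follows from a uniform law of large numbers over these regions with
tolerance `ε = α³ / (100 k⁴ L²)`.

The regions have small bracketing numbers. Normalise the largest coefficient of `q` to modulus 1 and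
round the coefficients to a fine grid. On a box for the coordinates that occur, rounding changes the
sign of `q` only where `|q|` is tiny. The small ball estimate `stdGaussianPi_smallBall_le` bounds
the mass of that set by freezing all coordinates but one and looking at a univariate quadratic. The
number of brackets of size `2⁻ʲ` is then at most `exp (K (j + 1))` with `K` of order `M log (d + 1)
+ M²` (`card_sparseBrackets_le`, `exists_mem_sparseBrackets`).

A union bound at the single scale `ε` would cost a factor `log (1/ε)`, which the sample size does
not provide. Chaining avoids it (`measureReal_exists_lt_abs_empFreq_sub_le`): a region is approached
through its brackets at levels `0, 1, …, J`, successive differences have measure of order `2⁻ʲ`, and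
Bernstein's inequality exploits this small variance. The result needs `N` of order `(K + log (1/τ))
/ ε²`. Since `K + log (1/τ)` is of order at most `k⁴ log (d/τ)` and `ε⁻²` contributes `α⁻⁶ k⁸ L⁴`,
this is the stated bound. -/

/-- The fraction of the points of the sample `S` that lie in `D`. -/
noncomputable def empFreq {𝓧 : Type*} {N : ℕ} (S : Fin N → 𝓧) (D : Set 𝓧) : ℝ :=
  (∑ i, D.indicator (fun _ => (1 : ℝ)) (S i)) / N

/-! ### Empirical frequencies of sets -/

section Frequency

variable {𝓧 : Type*} {N : ℕ}

theorem empFreq_eq_ncard_div (S : Fin N → 𝓧) (D : Set 𝓧) :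
    empFreq S D = ({i | S i ∈ D}.ncard : ℝ) / N := by
  classical
  unfold empFreq
  congr 1
  rw [Set.ncard_eq_toFinset_card']
  simp [Set.indicator_apply]

theorem empFreq_nonneg (S : Fin N → 𝓧) (D : Set 𝓧) : 0 ≤ empFreq S D :=
  div_nonneg (Finset.sum_nonneg fun _ _ => Set.indicator_nonneg (fun _ _ => zero_le_one) _)
    (Nat.cast_nonneg _)

theorem empFreq_mono (S : Fin N → 𝓧) {D D' : Set 𝓧} (h : D ⊆ D') :
    empFreq S D ≤ empFreq S D' := by
  unfold empFreq
  refine div_le_div_of_nonneg_right (Finset.sum_le_sum fun i _ => ?_) (Nat.cast_nonneg _)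
  exact Set.indicator_le_indicator_of_subset h (fun _ => zero_le_one) _

theorem empFreq_le_one (S : Fin N → 𝓧) (D : Set 𝓧) : empFreq S D ≤ 1 := by
  refine div_le_one_of_le₀ ?_ (Nat.cast_nonneg _)
  refine (Finset.sum_le_card_nsmul Finset.univ _ 1 fun i _ => ?_).trans (by simp)
  exact Set.indicator_le_self' (fun _ _ => zero_le_one) _

theorem empFreq_diff_add_inter (S : Fin N → 𝓧) (D D' : Set 𝓧) :
    empFreq S (D \ D') + empFreq S (D ∩ D') = empFreq S D := by
  unfold empFreq
  rw [← add_div, ← Finset.sum_add_distrib]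
  congr 2
  ext i
  by_cases h : S i ∈ D <;> by_cases h' : S i ∈ D' <;> simp [h, h']

end Frequency

/-! ### Bernstein's inequality for bounded variables and for frequencies -/

section Bernstein

variable {𝓧 Ω : Type*} [MeasurableSpace 𝓧] [MeasurableSpace Ω] {ν : Measure 𝓧}
  [IsProbabilityMeasure ν] {P : Measure Ω} [IsProbabilityMeasure P] {N : ℕ}
  {X : Fin N → Ω → 𝓧}

theorem Real.exp_le_one_add_add_sq {x : ℝ} (hx : |x| ≤ 1) : Real.exp x ≤ 1 + x + x ^ 2 := by
  have := (abs_le.1 (Real.abs_exp_sub_one_sub_id_le hx)).2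
  linarith

theorem integrable_of_abs_le_one {g : 𝓧 → ℝ} (hg : Measurable g) (hb : ∀ x, |g x| ≤ 1) :
    Integrable g ν :=
  Integrable.of_bound hg.aestronglyMeasurable 1 (.of_forall hb)

/-- Integrate `exp y ≤ 1 + y + y²` at `y = s g`; the linear term vanishes by centring. The
restriction `s ≤ 1` keeps `|y| ≤ 1`. -/
theorem mgf_le_exp_of_abs_le_one {g : 𝓧 → ℝ} (hg : Measurable g) (hb : ∀ x, |g x| ≤ 1)
    (h0 : ∫ x, g x ∂ν = 0) {σ s : ℝ} (hσ : ∫ x, g x ^ 2 ∂ν ≤ σ) (hs0 : 0 ≤ s) (hs1 : s ≤ 1) :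
    mgf g ν s ≤ Real.exp (s ^ 2 * σ) := by
  have hgi := integrable_of_abs_le_one (ν := ν) hg hb
  have hg2 : Integrable (fun x => g x ^ 2) ν :=
    integrable_of_abs_le_one (hg.pow_const 2) fun x => by
      rw [abs_pow]; exact pow_le_one₀ (abs_nonneg _) (hb x)
  have hsg : ∀ x, |s * g x| ≤ 1 := fun x => by
    rw [abs_mul, abs_of_nonneg hs0]
    exact mul_le_one₀ hs1 (abs_nonneg _) (hb x)
  have h1 : mgf g ν s ≤ ∫ x, (1 + s * g x + s ^ 2 * g x ^ 2) ∂ν := by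
    refine integral_mono ?_ ?_ fun x => ?_
    · refine Integrable.of_bound (C := Real.exp 1)
        (Real.measurable_exp.comp (hg.const_mul s)).aestronglyMeasurable (.of_forall fun x => ?_)
      rw [Real.norm_eq_abs, abs_of_pos (Real.exp_pos _)]
      exact Real.exp_le_exp.2 ((le_abs_self _).trans (hsg x))
    · exact ((integrable_const _).add (hgi.const_mul s)).add (hg2.const_mul _)
    · have := Real.exp_le_one_add_add_sq (hsg x)
      simp only
      linarith [mul_pow s (g x) 2]
  have h2 : ∫ x, (1 + s * g x + s ^ 2 * g x ^ 2) ∂ν = 1 + s ^ 2 * ∫ x, g x ^ 2 ∂ν := by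
    rw [integral_add (f := fun x => 1 + s * g x) ((integrable_const _).add (hgi.const_mul s))
        (hg2.const_mul _), integral_add (integrable_const _) (hgi.const_mul s),
      integral_const_mul, integral_const_mul,
      h0]
    simp
  calc mgf g ν s ≤ 1 + s ^ 2 * σ := by
        rw [h2] at h1
        nlinarith [mul_le_mul_of_nonneg_left hσ (sq_nonneg s)]
    _ ≤ _ := by linarith [Real.add_one_le_exp (s ^ 2 * σ)]

/-- One-sided Bernstein inequality. -/
theorem measureReal_le_sum_le_exp (hX : ∀ i, HasLaw (X i) ν P) (hind : iIndepFun X P)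
    {g : 𝓧 → ℝ} (hg : Measurable g) (hb : ∀ x, |g x| ≤ 1)
    (h0 : ∫ x, g x ∂ν = 0) {σ s : ℝ} (hσ : ∫ x, g x ^ 2 ∂ν ≤ σ) (hs0 : 0 ≤ s) (hs1 : s ≤ 1)
    (t : ℝ) :
    P.real {ω | N * t ≤ ∑ i, g (X i ω)} ≤ Real.exp (N * (s ^ 2 * σ - s * t)) := by
  have hm : ∀ i, AEMeasurable (fun ω => g (X i ω)) P := fun i =>
    hg.comp_aemeasurable (hX i).aemeasurable
  have hind' : iIndepFun (fun i ω => g (X i ω)) P := hind.comp (fun _ => g) fun _ => hg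
  have hint : Integrable (fun ω => Real.exp (s * (∑ i, fun ω => g (X i ω)) ω)) P := by
    refine Integrable.of_bound (C := Real.exp N) ?_ (.of_forall fun ω => ?_)
    · exact (Real.measurable_exp.comp_aemeasurable
        ((Finset.aemeasurable_sum _ fun i _ => hm i).const_mul s)).aestronglyMeasurable
    · rw [Real.norm_eq_abs, abs_of_pos (Real.exp_pos _), Real.exp_le_exp, Finset.sum_apply]
      have h1 : |∑ i, g (X i ω)| ≤ N := by
        refine (Finset.abs_sum_le_sum_abs _ _).trans ?_
        refine (Finset.sum_le_card_nsmul Finset.univ _ 1 fun i _ => hb _).trans (by simp)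
      calc s * ∑ i, g (X i ω) ≤ s * |∑ i, g (X i ω)| := by gcongr; exact le_abs_self _
        _ ≤ 1 * |∑ i, g (X i ω)| := by gcongr
        _ ≤ N := by linarith
  have h := measure_ge_le_exp_mul_mgf (μ := P) (N * t) hs0 hint
  have h1 : mgf (∑ i, fun ω => g (X i ω)) P s ≤ Real.exp (s ^ 2 * σ) ^ N := by
    rw [hind'.mgf_sum₀ hm]
    refine (Finset.prod_le_prod (fun i _ => mgf_nonneg) fun i _ => ?_).trans
      (by rw [Finset.prod_const, Finset.card_univ, Fintype.card_fin])
    have : mgf (fun ω => g (X i ω)) P s = mgf g ν s := by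
      unfold mgf
      exact (hX i).integral_comp (f := fun x => Real.exp (s * g x))
        (Real.measurable_exp.comp (hg.const_mul s)).aestronglyMeasurable
    rw [this]
    exact mgf_le_exp_of_abs_le_one hg hb h0 hσ hs0 hs1
  simp only [Finset.sum_apply] at h
  refine h.trans ((mul_le_mul_of_nonneg_left h1 (Real.exp_pos _).le).trans ?_)
  rw [← Real.exp_nat_mul, ← Real.exp_add]
  exact le_of_eq (by ring_nf)

/-- Bernstein inequality for the empirical frequency of a set. -/
theorem measureReal_le_abs_empFreq_sub (hX : ∀ i, HasLaw (X i) ν P) (hind : iIndepFun X P)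
    (hN : 0 < N) {D : Set 𝓧} (hD : MeasurableSet D) {σ s : ℝ} (hσ : ν.real D ≤ σ)
    (hs0 : 0 ≤ s) (hs1 : s ≤ 1) (t : ℝ) :
    P.real {ω | t ≤ |empFreq (fun i => X i ω) D - ν.real D|} ≤
      2 * Real.exp (N * (s ^ 2 * σ - s * t)) := by
  set p := ν.real D with hp
  have hp0 : 0 ≤ p := measureReal_nonneg
  have hp1 : p ≤ 1 := measureReal_le_one
  set f : 𝓧 → ℝ := D.indicator (fun _ => (1 : ℝ)) with hf
  have hfm : Measurable f := measurable_const.indicator hD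
  have hfb : ∀ x, f x = 0 ∨ f x = 1 := fun x => by
    by_cases h : x ∈ D <;> simp [hf, h]
  have hfi : Integrable f ν := (integrable_const _).indicator hD
  have hfint : ∫ x, f x ∂ν = p := by rw [hf, integral_indicator hD]; simp [hp]
  have hb : ∀ x, |f x - p| ≤ 1 := fun x => by
    rcases hfb x with h | h <;> rw [h, abs_le] <;> constructor <;> linarith
  have h0 : ∫ x, (f x - p) ∂ν = 0 := by
    rw [integral_sub hfi (integrable_const _), hfint]; simp
  -- Since `f² = f`, the variance is `p - p² ≤ p ≤ σ`: sets of small measure fluctuate little, which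
  -- is what chaining exploits.
  have h2 : ∫ x, (f x - p) ^ 2 ∂ν ≤ σ := by
    have : ∀ x, (f x - p) ^ 2 = (1 - 2 * p) * f x + p ^ 2 := fun x => by
      rcases hfb x with h | h <;> rw [h] <;> ring
    simp_rw [this]
    rw [integral_add (hfi.const_mul _) (integrable_const _), integral_const_mul, hfint]
    simp
    nlinarith
  have hA := measureReal_le_sum_le_exp hX hind (g := fun x => f x - p)
    (hfm.sub_const p) hb h0 h2 hs0 hs1 t
  have hB := measureReal_le_sum_le_exp hX hind (g := fun x => -(f x - p))
    (hfm.sub_const p).neg (fun x => by rw [abs_neg]; exact hb x)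
    (by rw [integral_neg, h0, neg_zero]) (by simpa only [neg_sq] using h2) hs0 hs1 t
  have hN' : (0 : ℝ) < N := by exact_mod_cast hN
  have hsub : {ω | t ≤ |empFreq (fun i => X i ω) D - p|} ⊆
      {ω | N * t ≤ ∑ i, (f (X i ω) - p)} ∪ {ω | N * t ≤ ∑ i, -(f (X i ω) - p)} := by
    intro ω hω
    rw [Set.mem_ofPred_eq] at hω
    have hs : ∑ i, (f (X i ω) - p) = N * (empFreq (fun i => X i ω) D - p) := by
      rw [Finset.sum_sub_distrib, empFreq, mul_sub, mul_div_cancel₀ _ hN'.ne']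
      simp [hf]
    simp only [Set.mem_union, Set.mem_ofPred_eq, Finset.sum_neg_distrib, hs, ← mul_neg]
    rcases le_abs.1 hω with h | h
    · exact Or.inl (by gcongr)
    · exact Or.inr (by gcongr)
  calc _ ≤ _ := measureReal_mono hsub
    _ ≤ _ := measureReal_union_le _ _
    _ ≤ _ := by linarith

end Bernstein

/-! ### Chaining along brackets of geometrically decreasing size -/

section Chaining

open Classical in
/-- The sets whose empirical frequencies control the passage from level `j` to level `j + 1` of a
chain of bracketings. -/
noncomputable def chainLinks {𝓧 : Type*} [MeasurableSpace 𝓧] (ν : Measure 𝓧)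
    (B : ℕ → Finset (Set 𝓧 × Set 𝓧)) (j : ℕ) : Finset (Set 𝓧) :=
  ((B j ×ˢ B (j + 1)).image (fun b => b.2.1 \ b.1.1) ∪
    (B j ×ˢ B (j + 1)).image (fun b => b.1.1 \ b.2.1) ∪
    (B (j + 1)).image (fun b => b.2 \ b.1)).filter
    fun D => ν.real D ≤ 3 * (1 / 2) ^ (j + 1)

variable {𝓧 : Type*} [MeasurableSpace 𝓧] {ν : Measure 𝓧}
  {B : ℕ → Finset (Set 𝓧 × Set 𝓧)}

theorem card_chainLinks_le {K : ℝ} (hK : 0 ≤ K)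
    (hcard : ∀ j, ((B j).card : ℝ) ≤ Real.exp (K * (j + 1))) (j : ℕ) :
    ((chainLinks ν B j).card : ℝ) ≤ 3 * Real.exp (2 * K * (j + 2)) := by
  classical
  have h1 := hcard j
  have h2 := hcard (j + 1)
  push_cast at h2
  have hj : (0 : ℝ) ≤ j := Nat.cast_nonneg j
  have hprod : ((B j).card : ℝ) * (B (j + 1)).card ≤ Real.exp (2 * K * (j + 2)) := by
    calc _ ≤ Real.exp (K * (j + 1)) * Real.exp (K * (j + 1 + 1)) := by gcongr
      _ ≤ _ := by
        rw [← Real.exp_add]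
        refine Real.exp_le_exp.2 ?_
        nlinarith
  have hsingle : ((B (j + 1)).card : ℝ) ≤ Real.exp (2 * K * (j + 2)) := by
    refine h2.trans (Real.exp_le_exp.2 ?_)
    nlinarith [mul_nonneg hK hj]
  have hc : (chainLinks ν B j).card ≤
      (B j).card * (B (j + 1)).card + (B j).card * (B (j + 1)).card + (B (j + 1)).card := by
    refine (Finset.card_filter_le _ _).trans ((Finset.card_union_le _ _).trans ?_)
    refine add_le_add ((Finset.card_union_le _ _).trans (add_le_add ?_ ?_)) Finset.card_image_le
    all_goals exact Finset.card_image_le.trans (Finset.card_product _ _).le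
  have hc' : ((chainLinks ν B j).card : ℝ) ≤
      (B j).card * (B (j + 1)).card + (B j).card * (B (j + 1)).card + (B (j + 1)).card := by
    exact_mod_cast hc
  linarith

theorem measurableSet_of_mem_chainLinks
    (hmeas : ∀ j, ∀ b ∈ B j, MeasurableSet b.1 ∧ MeasurableSet b.2) {j : ℕ} {D : Set 𝓧}
    (hD : D ∈ chainLinks ν B j) : MeasurableSet D := by
  classical
  simp only [chainLinks, Finset.mem_filter, Finset.mem_union, Finset.mem_image,
    Finset.mem_product] at hD
  obtain ⟨(⟨b, ⟨h1, h2⟩, rfl⟩ | ⟨b, ⟨h1, h2⟩, rfl⟩) | ⟨b, h1, rfl⟩, -⟩ := hD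
  · exact (hmeas _ _ h2).1.diff (hmeas _ _ h1).1
  · exact (hmeas _ _ h1).1.diff (hmeas _ _ h2).1
  · exact (hmeas _ _ h1).2.diff (hmeas _ _ h1).1

theorem measureReal_le_of_mem_chainLinks {j : ℕ} {D : Set 𝓧}
    (hD : D ∈ chainLinks ν B j) : ν.real D ≤ 3 * (1 / 2) ^ (j + 1) := by
  classical
  exact (Finset.mem_filter.1 hD).2

variable [IsProbabilityMeasure ν]

theorem sum_geometric_three_quarters_le (n : ℕ) :
    ∑ j ∈ Finset.range n, (3 / 4 : ℝ) ^ j ≤ 4 := by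
  rw [geom_sum_eq (by norm_num)]
  have : (0 : ℝ) ≤ (3 / 4) ^ n := by positivity
  rw [div_le_iff_of_neg (by norm_num)]
  linarith

/-- If all links of the chain have empirical frequencies close to their measures, then so has
every bracketed set. -/
theorem abs_empFreq_sub_le_of_chainLinks {N : ℕ} (S : Fin N → 𝓧) {A : Set 𝓧}
    (hB0 : B 0 = {(∅, Set.univ)})
    (hmeas : ∀ j, ∀ b ∈ B j, MeasurableSet b.1 ∧ MeasurableSet b.2)
    (hsmall : ∀ j, ∀ b ∈ B j, ν.real (b.2 \ b.1) ≤ (1 / 2) ^ j)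
    (hA : ∀ j, ∃ b ∈ B j, b.1 ⊆ A ∧ A ⊆ b.2) {J : ℕ} {ε : ℝ} (hJ : 0 < J) (hε : 0 < ε)
    (hJε : (1 / 2) ^ J ≤ ε / 4)
    (hlinks : ∀ j < J, ∀ D ∈ chainLinks ν B j,
      |empFreq S D - ν.real D| ≤ ε / 32 * (3 / 4) ^ j) :
    |empFreq S A - ν.real A| ≤ ε := by
  classical
  choose b hbB hbl hbu using hA
  -- The chain of lower brackets starts at the empty set, where frequency and measure agree exactly.
  have hb0 : (b 0).1 = ∅ := by
    have := hbB 0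
    rw [hB0, Finset.mem_singleton] at this
    rw [this]
  have hml : ∀ j, MeasurableSet (b j).1 := fun j => (hmeas j _ (hbB j)).1
  have hpow : ∀ j : ℕ, (1 / 2 : ℝ) ^ j = 2 * (1 / 2) ^ (j + 1) := fun j => by ring
  have hpos : ∀ j : ℕ, (0 : ℝ) < (1 / 2) ^ j := fun j => by positivity
  -- Both brackets enclose `A`, so `(b (j + 1)).1 ⊆ A ⊆ (b j).2` and this difference lies in the gap
  -- of `b j`, although the brackets need not be nested.
  have hmem1 : ∀ j, (b (j + 1)).1 \ (b j).1 ∈ chainLinks ν B j := fun j => by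
    refine Finset.mem_filter.2 ⟨Finset.mem_union_left _ (Finset.mem_union_left _
      (Finset.mem_image.2 ⟨(b j, b (j + 1)), Finset.mem_product.2 ⟨hbB _, hbB _⟩, rfl⟩)), ?_⟩
    have h1 : ν.real ((b (j + 1)).1 \ (b j).1) ≤ ν.real ((b j).2 \ (b j).1) :=
      measureReal_mono (Set.sdiff_subset_sdiff_left ((hbl _).trans (hbu _)))
    have h2 := hsmall j _ (hbB j)
    linarith [hpow j, hpos (j + 1)]
  have hmem2 : ∀ j, (b j).1 \ (b (j + 1)).1 ∈ chainLinks ν B j := fun j => by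
    refine Finset.mem_filter.2 ⟨Finset.mem_union_left _ (Finset.mem_union_right _
      (Finset.mem_image.2 ⟨(b j, b (j + 1)), Finset.mem_product.2 ⟨hbB _, hbB _⟩, rfl⟩)), ?_⟩
    have h1 : ν.real ((b j).1 \ (b (j + 1)).1) ≤ ν.real ((b (j + 1)).2 \ (b (j + 1)).1) :=
      measureReal_mono (Set.sdiff_subset_sdiff_left ((hbl _).trans (hbu _)))
    have h2 := hsmall (j + 1) _ (hbB (j + 1))
    linarith [hpos (j + 1)]
  have hmem3 : ∀ j, (b (j + 1)).2 \ (b (j + 1)).1 ∈ chainLinks ν B j := fun j => by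
    refine Finset.mem_filter.2 ⟨Finset.mem_union_right _
      (Finset.mem_image.2 ⟨b (j + 1), hbB _, rfl⟩), ?_⟩
    have h2 := hsmall (j + 1) _ (hbB (j + 1))
    linarith [hpos (j + 1)]
  have hdecE : ∀ D D' : Set 𝓧, empFreq S D' - empFreq S D =
      empFreq S (D' \ D) - empFreq S (D \ D') := fun D D' => by
    rw [← empFreq_diff_add_inter S D D', ← empFreq_diff_add_inter S D' D, Set.inter_comm]
    ring
  have hdecN : ∀ D D' : Set 𝓧, MeasurableSet D → MeasurableSet D' → ν.real D' - ν.real D =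
      ν.real (D' \ D) - ν.real (D \ D') := fun D D' h h' => by
    rw [← measureReal_inter_add_sdiff (μ := ν) (s := D) h',
      ← measureReal_inter_add_sdiff (μ := ν) (s := D') h, Set.inter_comm]
    ring
  have hchain : ∀ n ≤ J, |empFreq S (b n).1 - ν.real (b n).1| ≤
      ∑ j ∈ Finset.range n, 2 * (ε / 32 * (3 / 4) ^ j) := by
    intro n
    induction n with
    | zero =>
      intro _
      rw [hb0]
      simp [empFreq]
    | succ n ih =>
      intro hn
      rw [Finset.sum_range_succ]
      have h0 := ih (by omega)
      have h1 := hlinks n (by omega) _ (hmem1 n)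
      have h2 := hlinks n (by omega) _ (hmem2 n)
      have e1 := hdecE (b n).1 (b (n + 1)).1
      have e2 := hdecN (b n).1 (b (n + 1)).1 (hml _) (hml _)
      rw [abs_le] at *
      constructor <;> linarith
  have hsum : ∑ j ∈ Finset.range J, 2 * (ε / 32 * (3 / 4) ^ j) ≤ ε / 4 := by
    have := sum_geometric_three_quarters_le J
    rw [← Finset.mul_sum, ← Finset.mul_sum]
    nlinarith
  -- Error budget: `ε / 4` along the chain, `ε / 4` for the measure of the last gap and at most `ε /
  -- 32` for the deviation of its frequency.
  have hlast := hchain J le_rfl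
  obtain ⟨i, rfl⟩ : ∃ i, J = i + 1 := ⟨J - 1, by omega⟩
  have hgap := hlinks i (by omega) _ (hmem3 i)
  have hpw : (3 / 4 : ℝ) ^ i ≤ 1 := pow_le_one₀ (by norm_num) (by norm_num)
  have hν := hsmall (i + 1) _ (hbB (i + 1))
  have hEu : empFreq S (b (i + 1)).2 ≤
      empFreq S (b (i + 1)).1 + empFreq S ((b (i + 1)).2 \ (b (i + 1)).1) := by
    have h1 := empFreq_diff_add_inter S (b (i + 1)).2 (b (i + 1)).1
    have h2 := empFreq_mono S (Set.inter_subset_right (s := (b (i + 1)).2) (t := (b (i + 1)).1))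
    linarith
  have hNu : ν.real (b (i + 1)).2 ≤
      ν.real (b (i + 1)).1 + ν.real ((b (i + 1)).2 \ (b (i + 1)).1) := by
    have h1 := measureReal_inter_add_sdiff (μ := ν) (s := (b (i + 1)).2) (hml (i + 1))
    have h2 := measureReal_mono (μ := ν)
      (Set.inter_subset_right (s := (b (i + 1)).2) (t := (b (i + 1)).1))
    linarith
  have hE1 := empFreq_mono S (hbl (i + 1))
  have hE2 := empFreq_mono S (hbu (i + 1))
  have hN1 := measureReal_mono (μ := ν) (hbl (i + 1))
  have hN2 := measureReal_mono (μ := ν) (hbu (i + 1))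
  have : ε / 32 * (3 / 4) ^ i ≤ ε / 32 := mul_le_of_le_one_right (by positivity) hpw
  rw [abs_le] at *
  constructor <;> linarith

/-- The final level must make the last gap negligible, yet stay comparable to `ε`, so that the
Bernstein parameter remains at most 1 at all earlier levels. -/
theorem exists_half_pow_near {ε : ℝ} (hε : 0 < ε) (hε1 : ε ≤ 1) :
    ∃ J : ℕ, 0 < J ∧ (1 / 2 : ℝ) ^ J ≤ ε / 4 ∧ ε ≤ 8 * (1 / 2) ^ J := by
  obtain ⟨n, h1, h2⟩ := exists_nat_pow_near_of_lt_one (x := ε / 4) (y := (1 / 2 : ℝ))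
    (by positivity) (by linarith) (by norm_num) (by norm_num)
  refine ⟨n + 1, by omega, h1.le, ?_⟩
  rw [pow_succ]
  linarith

theorem one_add_mul_le_nine_eighths_pow (j : ℕ) : ((j : ℝ) + 8) / 8 ≤ (9 / 8) ^ j := by
  have := one_add_mul_le_pow (a := (1 / 8 : ℝ)) (by norm_num) j
  norm_num at this
  linarith

theorem sum_exp_neg_le (J : ℕ) : ∑ j ∈ Finset.range J, 6 * Real.exp (-((j : ℝ) + 8)) ≤ 1 := by
  have h : ∀ j : ℕ, 6 * Real.exp (-((j : ℝ) + 8)) ≤ 6 / 256 * (1 / 2) ^ j := fun j => by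
    have h1 : Real.exp (-((j : ℝ) + 8)) = Real.exp (-1) ^ (j + 8) := by
      rw [← Real.exp_nat_mul]; push_cast; ring_nf
    have h2 : Real.exp (-1) ≤ 1 / 2 := by
      rw [Real.exp_neg, one_div]
      exact inv_anti₀ two_pos (by linarith [Real.add_one_le_exp (1 : ℝ)])
    have h3 : Real.exp (-1) ^ (j + 8) ≤ (1 / 2) ^ (j + 8) :=
      pow_le_pow_left₀ (Real.exp_pos _).le h2 _
    rw [h1]
    refine (mul_le_mul_of_nonneg_left h3 (by norm_num)).trans_eq ?_
    rw [pow_add]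
    ring
  refine (Finset.sum_le_sum fun j _ => h j).trans ?_
  have h4 : ∑ j ∈ Finset.range J, (1 / 2 : ℝ) ^ j ≤ ∑ j ∈ Finset.range J, (3 / 4 : ℝ) ^ j :=
    Finset.sum_le_sum fun j _ => pow_le_pow_left₀ (by norm_num) (by norm_num) j
  rw [← Finset.mul_sum]
  linarith [sum_geometric_three_quarters_le J]

variable {Ω : Type*} [MeasurableSpace Ω] {P : Measure Ω} [IsProbabilityMeasure P] {N : ℕ}
  {X : Fin N → Ω → 𝓧}

/-- Uniform convergence of empirical frequencies, without logarithmic loss, over a class of sets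
with exponential bracketing numbers. -/
theorem measureReal_exists_lt_abs_empFreq_sub_le
    (hX : ∀ i, HasLaw (X i) ν P) (hind : iIndepFun X P) {𝒜 : Set (Set 𝓧)} {K : ℝ} (hK : 1 ≤ K)
    (hB0 : B 0 = {(∅, Set.univ)})
    (hmeas : ∀ j, ∀ b ∈ B j, MeasurableSet b.1 ∧ MeasurableSet b.2)
    (hsmall : ∀ j, ∀ b ∈ B j, ν.real (b.2 \ b.1) ≤ (1 / 2) ^ j)
    (hcard : ∀ j, ((B j).card : ℝ) ≤ Real.exp (K * (j + 1)))
    (hA : ∀ A ∈ 𝒜, ∀ j, ∃ b ∈ B j, b.1 ⊆ A ∧ A ⊆ b.2) {ε τ : ℝ} (hε : 0 < ε) (hε1 : ε ≤ 1)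
    (hτ : 0 < τ) (hτ1 : τ < 1) (hN : 196608 * (K + Real.log (1 / τ)) / ε ^ 2 ≤ N) :
    P.real {ω | ∃ A ∈ 𝒜, ε < |empFreq (fun i => X i ω) A - ν.real A|} ≤ τ := by
  obtain ⟨J, hJ, hJε, hεJ⟩ := exists_half_pow_near hε hε1
  set T := K + Real.log (1 / τ) with hT
  have hlog : 0 ≤ Real.log (1 / τ) := Real.log_nonneg (by rw [le_div_iff₀ hτ]; linarith)
  have hT1 : 1 ≤ T := by linarith
  have hNT : 196608 * T ≤ N * ε ^ 2 := by rwa [div_le_iff₀ (by positivity)] at hN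
  have hNpos : 0 < N := by
    have : (0 : ℝ) < N := lt_of_lt_of_le (by positivity) hN
    exact_mod_cast this
  have hsub : {ω | ∃ A ∈ 𝒜, ε < |empFreq (fun i => X i ω) A - ν.real A|} ⊆
      ⋃ j ∈ Finset.range J, ⋃ D ∈ chainLinks ν B j,
        {ω | ε / 32 * (3 / 4) ^ j ≤ |empFreq (fun i => X i ω) D - ν.real D|} := by
    intro ω hω
    obtain ⟨A, hA𝒜, hlt⟩ := hω
    by_contra hnot
    simp only [Set.mem_iUnion, Finset.mem_range, Set.mem_ofPred_eq, not_exists, not_le] at hnot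
    refine absurd hlt (not_lt.2 ?_)
    exact abs_empFreq_sub_le_of_chainLinks _ hB0 hmeas hsmall (hA A hA𝒜) hJ hε hJε
      fun j hj D hD => (hnot j hj D hD).le
  have hone : ∀ j < J, ∀ D ∈ chainLinks ν B j,
      P.real {ω | ε / 32 * (3 / 4) ^ j ≤ |empFreq (fun i => X i ω) D - ν.real D|} ≤
        2 * Real.exp (-4 * T * (j + 8)) := by
    intro j hj D hD
    -- This `s` is the optimum `t / (2σ)` for `t = ε / 32 * (3 / 4) ^ j` and `σ = 3 * (1 / 2) ^ (j +
    -- 1)`. It is admissible because `j < J` forces `ε ≤ 4 * (1 / 2) ^ j`.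
    have hs1 : ε * (3 / 2) ^ j / 96 ≤ 1 := by
      have h1 : (1 / 2 : ℝ) ^ J ≤ (1 / 2) ^ (j + 1) :=
        pow_le_pow_of_le_one (by norm_num) (by norm_num) hj
      have h2 : (3 / 4 : ℝ) ^ j ≤ 1 := pow_le_one₀ (by norm_num) (by norm_num)
      have h3 : (1 / 2 : ℝ) ^ j * (3 / 2) ^ j = (3 / 4) ^ j := by rw [← mul_pow]; norm_num
      have h4 : ε ≤ 4 * (1 / 2) ^ j := by rw [pow_succ] at h1; linarith
      have h5 := mul_le_mul_of_nonneg_right h4 (by positivity : (0 : ℝ) ≤ (3 / 2) ^ j)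
      nlinarith
    refine (measureReal_le_abs_empFreq_sub hX hind hNpos
      (measurableSet_of_mem_chainLinks hmeas hD) (measureReal_le_of_mem_chainLinks hD)
      (s := ε * (3 / 2) ^ j / 96) (by positivity) hs1 _).trans ?_
    refine mul_le_mul_of_nonneg_left (Real.exp_le_exp.2 ?_) two_pos.le
    have h3 : ((3 / 2 : ℝ) ^ j) ^ 2 * (1 / 2) ^ j = (9 / 8) ^ j := by
      rw [← pow_mul, mul_comm j 2, pow_mul, ← mul_pow]; norm_num
    have h4 : (3 / 2 : ℝ) ^ j * (3 / 4) ^ j = (9 / 8) ^ j := by rw [← mul_pow]; norm_num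
    -- The exponent is `-N t² / (4σ)`. As `(3 / 4)² * 2 = 9 / 8 > 1`, it grows geometrically in `j`
    -- and beats the entropy, which is linear in `j`, while the tolerances remain summable.
    have h5 : (N : ℝ) * ((ε * (3 / 2) ^ j / 96) ^ 2 * (3 * (1 / 2) ^ (j + 1)) -
        ε * (3 / 2) ^ j / 96 * (ε / 32 * (3 / 4) ^ j)) = -(N * ε ^ 2 / 6144 * (9 / 8) ^ j) := by
      rw [pow_succ (1 / 2 : ℝ) j]
      linear_combination (N * ε ^ 2 / 6144 : ℝ) * h3 - (N * ε ^ 2 / 3072 : ℝ) * h4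
    rw [h5]
    have h6 := one_add_mul_le_nine_eighths_pow j
    have h7 : (32 * T) * (((j : ℝ) + 8) / 8) ≤ N * ε ^ 2 / 6144 * (9 / 8) ^ j :=
      mul_le_mul (by linarith) h6 (by positivity) (by positivity)
    linarith
  calc _ ≤ P.real (⋃ j ∈ Finset.range J, ⋃ D ∈ chainLinks ν B j,
        {ω | ε / 32 * (3 / 4) ^ j ≤ |empFreq (fun i => X i ω) D - ν.real D|}) :=
        measureReal_mono hsub (measure_ne_top _ _)
    _ ≤ ∑ j ∈ Finset.range J, ∑ D ∈ chainLinks ν B j,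
        P.real {ω | ε / 32 * (3 / 4) ^ j ≤ |empFreq (fun i => X i ω) D - ν.real D|} :=
        (measureReal_biUnion_finset_le _ _).trans
          (Finset.sum_le_sum fun j _ => measureReal_biUnion_finset_le _ _)
    _ ≤ ∑ j ∈ Finset.range J, τ * (6 * Real.exp (-((j : ℝ) + 8))) := by
        refine Finset.sum_le_sum fun j hj => ?_
        refine (Finset.sum_le_card_nsmul _ _ _ (hone j (Finset.mem_range.1 hj))).trans ?_
        rw [nsmul_eq_mul]
        have hj0 : (0 : ℝ) ≤ j := Nat.cast_nonneg j
        have hKT : K ≤ T := by linarith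
        have hτe : Real.exp (-Real.log (1 / τ)) = τ := by
          rw [one_div, Real.log_inv, neg_neg, Real.exp_log hτ]
        -- Here `T = K + log (1/τ)`: its `K` part pays for the number of links, its logarithm yields
        -- the factor `τ`, and the surplus makes the sum over `j` converge.
        calc _ ≤ 3 * Real.exp (2 * K * (j + 2)) * (2 * Real.exp (-4 * T * (j + 8))) := by
              gcongr
              exact card_chainLinks_le (by linarith) hcard j
          _ = 6 * Real.exp (2 * K * (j + 2) + -4 * T * (j + 8)) := by rw [Real.exp_add]; ring
          _ ≤ 6 * Real.exp (-Real.log (1 / τ) + -((j : ℝ) + 8)) := by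
              refine mul_le_mul_of_nonneg_left (Real.exp_le_exp.2 ?_) (by norm_num)
              nlinarith [mul_le_mul_of_nonneg_right hKT hj0, mul_le_mul_of_nonneg_right hT1 hj0]
          _ = _ := by rw [Real.exp_add, hτe]; ring
    _ ≤ τ * 1 := by
        rw [← Finset.mul_sum]
        gcongr
        exact sum_exp_neg_le J
    _ = τ := mul_one _

end Chaining

/-! ### Small ball estimates for sparse quadratic polynomials of a Gaussian vector -/

section SmallBall

theorem gaussianReal_Icc_le (x h : ℝ) :
    gaussianReal 0 1 (Set.Icc x (x + h)) ≤ ENNReal.ofReal h := by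
  rw [gaussianReal_apply 0 one_ne_zero]
  have hle : ∀ y, gaussianPDF 0 1 y ≤ 1 := fun y => by
    rw [gaussianPDF, ENNReal.ofReal_le_one, gaussianPDFReal]
    refine mul_le_one₀ (inv_le_one_of_one_le₀ ?_) (Real.exp_pos _).le (Real.exp_le_one_iff.2 ?_)
    · rw [Real.one_le_sqrt]
      simp only [NNReal.coe_one, mul_one]
      linarith [Real.pi_gt_three]
    · exact div_nonpos_of_nonpos_of_nonneg (neg_nonpos.2 (sq_nonneg _)) (by positivity)
  calc ∫⁻ y in Set.Icc x (x + h), gaussianPDF 0 1 y ≤ ∫⁻ _ in Set.Icc x (x + h), 1 :=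
        lintegral_mono fun y => hle y
    _ = ENNReal.ofReal h := by simp

/-- A bounded below set of reals without three `h`-separated points is covered by two intervals of
length `h`. -/
theorem exists_subset_Icc_union_Icc {S : Set ℝ} {h : ℝ} (hS : BddBelow S)
    (hsep : ∀ x ∈ S, ∀ y ∈ S, ∀ z ∈ S, h ≤ y - x → h ≤ z - y → False) :
    ∃ x y, S ⊆ Set.Icc x (x + h) ∪ Set.Icc y (y + h) := by
  -- The second interval starts at the infimum of what the first misses. A point `z` beyond both
  -- leaves room for `y`, and then `x`, chosen near these infima, with both gaps at least `h`.
  refine ⟨sInf S, sInf (S \ Set.Icc (sInf S) (sInf S + h)), fun z hz => ?_⟩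
  by_contra hnot
  rw [Set.mem_union, not_or] at hnot
  obtain ⟨hz1, hz2⟩ := hnot
  have hS' : BddBelow (S \ Set.Icc (sInf S) (sInf S + h)) := hS.mono Set.sdiff_subset
  have hz' : z ∈ S \ Set.Icc (sInf S) (sInf S + h) := ⟨hz, hz1⟩
  have hzlt : sInf (S \ Set.Icc (sInf S) (sInf S + h)) < z - h := by
    by_contra hle
    exact hz2 ⟨csInf_le hS' hz', by linarith⟩
  obtain ⟨y, ⟨hyS, hy⟩, hyz⟩ := exists_lt_of_csInf_lt ⟨z, hz'⟩ hzlt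
  have hylt : sInf S < y - h := by
    by_contra hle
    exact hy ⟨csInf_le hS hyS, by linarith⟩
  obtain ⟨x, hxS, hxy⟩ := exists_lt_of_csInf_lt ⟨y, hyS⟩ hylt
  exact hsep x hxS y hyS z hz (by linarith) (by linarith)

/-- Lagrange interpolation bound for the coefficients of a quadratic polynomial that is small at
three separated points. -/
theorem abs_coeff_mul_sq_le_of_separated {a b c ρ h t x y z : ℝ} (hρ : 1 ≤ ρ) (hh : 0 < h)
    (hh1 : h ≤ 1) (hx : |x| ≤ ρ) (hy : |y| ≤ ρ) (hxy : h ≤ y - x) (hyz : h ≤ z - y)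
    (hqx : |a * x ^ 2 + b * x + c| ≤ t) (hqy : |a * y ^ 2 + b * y + c| ≤ t)
    (hqz : |a * z ^ 2 + b * z + c| ≤ t) :
    |a| * h ^ 2 ≤ 6 * t * ρ ∧ |b| * h ^ 2 ≤ 6 * t * ρ := by
  have ht : 0 ≤ t := (abs_nonneg _).trans hqx
  -- `a * (p + q) + b` is the first divided difference over `p, q`. Those over `x, y` and `y, z`
  -- differ by `a * (z - x)`, which bounds `a`, and then `b`.
  have hdiff : ∀ p q : ℝ, h ≤ q - p → |a * p ^ 2 + b * p + c| ≤ t → |a * q ^ 2 + b * q + c| ≤ t →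
      |a * (p + q) + b| * h ≤ 2 * t := by
    intro p q hpq hp hq
    calc |a * (p + q) + b| * h ≤ |a * (p + q) + b| * |q - p| := by
          gcongr; exact hpq.trans (le_abs_self _)
      _ = |(a * q ^ 2 + b * q + c) - (a * p ^ 2 + b * p + c)| := by
          rw [← abs_mul]; ring_nf
      _ ≤ 2 * t := by
          rw [abs_le] at *; constructor <;> linarith
  have h1 := hdiff x y hxy hqx hqy
  have h2 := hdiff y z hyz hqy hqz
  have h3 : |a| * (2 * h) ≤ |a * (x + y) + b| + |a * (y + z) + b| := by
    calc |a| * (2 * h) ≤ |a| * |z - x| := by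
          gcongr; exact (by linarith : 2 * h ≤ z - x).trans (le_abs_self _)
      _ = |(a * (y + z) + b) - (a * (x + y) + b)| := by rw [← abs_mul]; ring_nf
      _ ≤ |a * (y + z) + b| + |a * (x + y) + b| := abs_sub _ _
      _ = _ := add_comm _ _
  have ha : |a| * h ^ 2 ≤ 2 * t := by nlinarith
  have hb : |b| ≤ |a * (x + y) + b| + |a| * (2 * ρ) := by
    have h4 : |x + y| ≤ 2 * ρ := (abs_add_le _ _).trans (by linarith)
    calc |b| = |(a * (x + y) + b) - a * (x + y)| := by ring_nf
      _ ≤ |a * (x + y) + b| + |a * (x + y)| := abs_sub _ _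
      _ ≤ _ := by rw [abs_mul a]; gcongr
  have htρ : t ≤ t * ρ := le_mul_of_one_le_right ht hρ
  refine ⟨by linarith, ?_⟩
  have h5 : |b| * h ^ 2 ≤ (|a * (x + y) + b| * h) * h + (|a| * h ^ 2) * (2 * ρ) := by
    nlinarith [mul_le_mul_of_nonneg_right hb (sq_nonneg h)]
  have h6 : (|a * (x + y) + b| * h) * h ≤ 2 * t * 1 :=
    mul_le_mul h1 hh1 hh.le (by linarith)
  have h7 : (|a| * h ^ 2) * (2 * ρ) ≤ 2 * t * (2 * ρ) := by gcongr
  linarith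

/-- Three `h`-separated points of the set would make both `|a|` and `|b|` smaller than `β`. So two
intervals of length `h` cover it, and the Gaussian density is at most 1. -/
theorem gaussianReal_abs_quadratic_le {a b c ρ h t β : ℝ} (hρ : 1 ≤ ρ) (hh : 0 < h)
    (hh1 : h ≤ 1) (ht : 6 * t * ρ < β * h ^ 2) (hβ : β ≤ |a| ∨ β ≤ |b|) :
    gaussianReal 0 1 {s | |s| ≤ ρ ∧ |a * s ^ 2 + b * s + c| ≤ t} ≤ ENNReal.ofReal (2 * h) := by
  obtain ⟨x, y, hxy⟩ := exists_subset_Icc_union_Icc (h := h)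
    (S := {s | |s| ≤ ρ ∧ |a * s ^ 2 + b * s + c| ≤ t})
    ⟨-ρ, fun s hs => (abs_le.1 hs.1).1⟩ (by
      rintro x ⟨hx, hqx⟩ y ⟨hy, hqy⟩ z ⟨-, hqz⟩ h1 h2
      obtain ⟨ha, hb⟩ := abs_coeff_mul_sq_le_of_separated hρ hh hh1 hx hy h1 h2 hqx hqy hqz
      rcases hβ with h | h
      · nlinarith [mul_le_mul_of_nonneg_right h (sq_nonneg ‹ℝ›)]
      · nlinarith)
  calc _ ≤ _ := measure_mono hxy
    _ ≤ _ := measure_union_le _ _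
    _ ≤ ENNReal.ofReal h + ENNReal.ofReal h :=
      add_le_add (gaussianReal_Icc_le _ _) (gaussianReal_Icc_le _ _)
    _ = _ := by rw [← ENNReal.ofReal_add hh.le hh.le, two_mul]

/-- Resampling one coordinate leaves a product of probability measures invariant. -/
theorem lintegral_pi_eq_lintegral_update {ι : Type*} [Fintype ι] [DecidableEq ι] {γ : ι → Measure ℝ}
    [∀ i, IsProbabilityMeasure (γ i)] {f : (ι → ℝ) → ENNReal} (hf : Measurable f) (i : ι) :
    ∫⁻ x, f x ∂Measure.pi γ = ∫⁻ x, ∫⁻ s, f (Function.update x i s) ∂γ i ∂Measure.pi γ := by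
  set g : (ι → ℝ) → ENNReal := fun x => ∫⁻ s, f (Function.update x i s) ∂γ i with hg
  have hgm : Measurable g := by
    rw [hg, ← lmarginal_singleton]
    exact hf.lmarginal _
  rw [lintegral_eq_lmarginal_univ (μ := γ) (f := f) 0,
    lintegral_eq_lmarginal_univ (μ := γ) (f := g) 0,
    lmarginal_erase' f hf (Finset.mem_univ i), lmarginal_erase' g hgm (Finset.mem_univ i)]
  congr 1
  simp [hg]

/-- Fubini in one coordinate: this reduces the multivariate small ball estimate to univariate
slices. -/
theorem measure_pi_le_of_forall_update {ι : Type*} [Fintype ι] [DecidableEq ι] {γ : ι → Measure ℝ}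
    [∀ i, IsProbabilityMeasure (γ i)] {S : Set (ι → ℝ)} (hS : MeasurableSet S) (i : ι)
    {c : ENNReal} (h : ∀ x, γ i {s | Function.update x i s ∈ S} ≤ c) :
    Measure.pi γ S ≤ c := by
  have hm : ∀ x : ι → ℝ, MeasurableSet {s | Function.update x i s ∈ S} := fun x =>
    measurable_update x hS
  rw [← lintegral_indicator_one hS,
    lintegral_pi_eq_lintegral_update (measurable_one.indicator hS) i]
  calc _ ≤ ∫⁻ _, c ∂Measure.pi γ := lintegral_mono fun x => by
        refine le_trans (le_of_eq ?_) (h x)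
        rw [← lintegral_indicator_one (hm x)]
        rfl
    _ = c := by simp

/-! ### Quadratic forms as functions of a single coordinate -/

section QuadraticForms

variable {ι : Type*} [Fintype ι] [DecidableEq ι]

/-- The quadratic form `∑ A_{ab} w_a w_b`. -/
def quadForm (A : ι → ι → ℝ) (w : ι → ℝ) : ℝ := ∑ a, ∑ b, A a b * (w a * w b)

/-- The part not involving `w_k` of half the partial derivative of a symmetric quadratic form. -/
def crossTerm (A : ι → ι → ℝ) (k : ι) (w : ι → ℝ) : ℝ := ∑ a ∈ Finset.univ.erase k, A k a * w a

theorem crossTerm_update (A : ι → ι → ℝ) (k : ι) (w : ι → ℝ) (s : ℝ) :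
    crossTerm A k (Function.update w k s) = crossTerm A k w := by
  refine Finset.sum_congr rfl fun a ha => ?_
  rw [Function.update_of_ne (Finset.ne_of_mem_erase ha)]

theorem crossTerm_update_of_ne (A : ι → ι → ℝ) {k l : ι} (hkl : l ≠ k) (w : ι → ℝ) (s : ℝ) :
    crossTerm A k (Function.update w l s) =
      A k l * s + ∑ a ∈ (Finset.univ.erase k).erase l, A k a * w a := by
  rw [crossTerm, ← Finset.add_sum_erase _ _ (Finset.mem_erase.2 ⟨hkl, Finset.mem_univ l⟩),
    Function.update_self]
  congr 1
  refine Finset.sum_congr rfl fun a ha => ?_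
  rw [Function.update_of_ne (Finset.ne_of_mem_erase ha)]

theorem quadForm_update (A : ι → ι → ℝ) (hA : ∀ a b, A a b = A b a) (k : ι) (w : ι → ℝ) (s : ℝ) :
    quadForm A (Function.update w k s) = A k k * s ^ 2 + 2 * crossTerm A k w * s +
      ∑ a ∈ Finset.univ.erase k, ∑ b ∈ Finset.univ.erase k, A a b * (w a * w b) := by
  have hw : ∀ a ∈ Finset.univ.erase k, Function.update w k s a = w a := fun a ha =>
    Function.update_of_ne (Finset.ne_of_mem_erase ha) _ _
  rw [quadForm, ← Finset.add_sum_erase _ _ (Finset.mem_univ k)]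
  have h1 : ∀ a, ∑ b, A a b * (Function.update w k s a * Function.update w k s b) =
      A a k * (Function.update w k s a * s) +
        ∑ b ∈ Finset.univ.erase k, A a b * (Function.update w k s a * w b) := fun a => by
    rw [← Finset.add_sum_erase _ _ (Finset.mem_univ k), Function.update_self]
    congr 1
    exact Finset.sum_congr rfl fun b hb => by rw [hw b hb]
  simp_rw [h1]
  rw [Finset.sum_add_distrib, Function.update_self]
  have h2 : ∑ a ∈ Finset.univ.erase k, A a k * (Function.update w k s a * s) =
      crossTerm A k w * s := by
    rw [crossTerm, Finset.sum_mul]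
    exact Finset.sum_congr rfl fun a ha => by rw [hw a ha, hA a k]; ring
  have h3 : ∑ b ∈ Finset.univ.erase k, A k b * (s * w b) = crossTerm A k w * s := by
    rw [crossTerm, Finset.sum_mul]
    exact Finset.sum_congr rfl fun a ha => by ring
  have h4 : ∑ a ∈ Finset.univ.erase k, ∑ b ∈ Finset.univ.erase k,
      A a b * (Function.update w k s a * w b) =
      ∑ a ∈ Finset.univ.erase k, ∑ b ∈ Finset.univ.erase k, A a b * (w a * w b) :=
    Finset.sum_congr rfl fun a ha => by rw [hw a ha]
  rw [h2, h3, h4]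
  ring

end QuadraticForms

variable {d : ℕ}

/-- The homogeneous coordinates `(1, z)` of a point `z`. -/
def homCoord (z : Fin d → ℝ) : Option (Fin d) → ℝ := fun a => a.elim 1 z

@[simp] theorem homCoord_none (z : Fin d → ℝ) : homCoord z none = 1 := rfl

@[simp] theorem homCoord_some (z : Fin d → ℝ) (i : Fin d) : homCoord z (some i) = z i := rfl

theorem homCoord_update (z : Fin d → ℝ) (i : Fin d) (s : ℝ) :
    homCoord (Function.update z i s) = Function.update (homCoord z) (some i) s := by
  ext a
  cases a with
  | none => rw [Function.update_of_ne (by simp)]; rfl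
  | some j =>
    by_cases h : j = i
    · subst h; simp
    · rw [Function.update_of_ne (by simpa using h)]; simp [h]

theorem measurable_homCoord (a : Option (Fin d)) :
    Measurable fun z : Fin d → ℝ => homCoord z a := by
  cases a with
  | none => exact measurable_const
  | some i => exact measurable_pi_apply i

theorem measurable_quadForm_homCoord (A : Option (Fin d) → Option (Fin d) → ℝ) :
    Measurable fun z : Fin d → ℝ => quadForm A (homCoord z) :=
  Finset.measurable_sum _ fun a _ => Finset.measurable_sum _ fun b _ =>
    ((measurable_homCoord a).mul (measurable_homCoord b)).const_mul _

theorem measurable_crossTerm_homCoord (A : Option (Fin d) → Option (Fin d) → ℝ)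
    (k : Option (Fin d)) : Measurable fun z : Fin d → ℝ => crossTerm A k (homCoord z) :=
  Finset.measurable_sum _ fun a _ => (measurable_homCoord a).const_mul _

/-- The standard Gaussian distribution as a product measure. -/
noncomputable abbrev stdGaussianPi (d : ℕ) : Measure (Fin d → ℝ) :=
  Measure.pi fun _ => gaussianReal 0 1

variable {A : Option (Fin d) → Option (Fin d) → ℝ} {u : ℝ}

theorem stdGaussianPi_diag_le (hA : ∀ a b, A a b = A b a) (hu : 0 < u) (hu8 : 8 * u ≤ 1)
    {i : Fin d} (hi : u ^ 8 ≤ |A (some i) (some i)|) :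
    stdGaussianPi d {z | |z i| ≤ 1 / u ∧ |quadForm A (homCoord z)| ≤ u ^ 16} ≤
      ENNReal.ofReal (2 * u) := by
  refine measure_pi_le_of_forall_update ?_ i fun x => ?_
  · exact (measurableSet_le (measurable_pi_apply i).abs measurable_const).inter
      (measurableSet_le (measurable_quadForm_homCoord A).abs measurable_const)
  · simp only [Set.mem_ofPred_eq, Function.update_self, homCoord_update, quadForm_update A hA]
    refine gaussianReal_abs_quadratic_le (β := u ^ 8) (by rw [le_div_iff₀ hu]; linarith) hu
      (by linarith) ?_ (Or.inl hi)
    rw [mul_one_div, div_lt_iff₀ hu]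
    have h1 : u ^ 5 ≤ u := pow_le_of_le_one hu.le (by linarith) (by norm_num)
    have h2 : 0 < u ^ 11 := by positivity
    nlinarith [mul_le_mul_of_nonneg_left h1 h2.le]

/-- As a function of `z i` alone, the form has linear coefficient `2 * crossTerm`, which does not
depend on `z i`. A slice is therefore either empty or governed by a linear coefficient of size at
least `u ^ 12`. -/
theorem stdGaussianPi_cross_le (hA : ∀ a b, A a b = A b a) (hu : 0 < u) (hu8 : 8 * u ≤ 1)
    (i : Fin d) :
    stdGaussianPi d {z | |z i| ≤ 1 / u ∧ u ^ 12 ≤ |2 * crossTerm A (some i) (homCoord z)| ∧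
      |quadForm A (homCoord z)| ≤ u ^ 16} ≤ ENNReal.ofReal (2 * u) := by
  refine measure_pi_le_of_forall_update ?_ i fun x => ?_
  · exact (measurableSet_le (measurable_pi_apply i).abs measurable_const).inter
      ((measurableSet_le measurable_const
        ((measurable_crossTerm_homCoord A _).const_mul 2).abs).inter
      (measurableSet_le (measurable_quadForm_homCoord A).abs measurable_const))
  · simp only [Set.mem_ofPred_eq, Function.update_self, homCoord_update, quadForm_update A hA,
      crossTerm_update]
    by_cases hx : u ^ 12 ≤ |2 * crossTerm A (some i) (homCoord x)|
    · simp only [hx, true_and]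
      refine gaussianReal_abs_quadratic_le (β := u ^ 12) (by rw [le_div_iff₀ hu]; linarith) hu
        (by linarith) ?_ (Or.inr hx)
      rw [mul_one_div, div_lt_iff₀ hu]
      have h2 : 0 < u ^ 15 := by positivity
      nlinarith
    · simp only [hx, false_and, and_false, Set.ofPred_false, measure_empty, zero_le]

/-- The cross term is affine in `z j` with slope `A (some i) (some j)`, so the univariate bound
applies with leading coefficient 0. -/
theorem stdGaussianPi_crossTerm_le (hu : 0 < u) (hu8 : 8 * u ≤ 1) {i j : Fin d} (hij : j ≠ i)
    (h : u ^ 8 ≤ |A (some i) (some j)|) :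
    stdGaussianPi d {z | |z j| ≤ 1 / u ∧ |2 * crossTerm A (some i) (homCoord z)| ≤ u ^ 12} ≤
      ENNReal.ofReal (2 * u) := by
  refine measure_pi_le_of_forall_update ?_ j fun x => ?_
  · exact (measurableSet_le (measurable_pi_apply j).abs measurable_const).inter
      (measurableSet_le ((measurable_crossTerm_homCoord A _).const_mul 2).abs measurable_const)
  · have hne : (some j : Option (Fin d)) ≠ some i := by simpa using hij
    simp only [Set.mem_ofPred_eq, Function.update_self, homCoord_update,
      crossTerm_update_of_ne A hne]
    have key := gaussianReal_abs_quadratic_le (a := 0) (b := 2 * A (some i) (some j))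
      (c := 2 * ∑ a ∈ (Finset.univ.erase (some i)).erase (some j), A (some i) a * homCoord x a)
      (ρ := 1 / u) (h := u) (t := u ^ 12) (β := u ^ 8) (by rw [le_div_iff₀ hu]; linarith) hu
      (by linarith) (by
        rw [mul_one_div, div_lt_iff₀ hu]
        have h2 : 0 < u ^ 11 := by positivity
        nlinarith) (Or.inr (by rw [abs_mul, abs_two]; linarith [abs_nonneg (A (some i) (some j))]))
    convert key using 5
    ring_nf

/-- Sums over the support of a sparse array. -/
theorem sum_abs_le_of_sparse {κ : Type*} {T s : Finset κ} {f : κ → ℝ} {M : ℕ} {c : ℝ}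
    (hc : 0 ≤ c) (hT : T.card ≤ M) (hs : ∀ x ∈ s, f x ≠ 0 → x ∈ T) (hf : ∀ x ∈ s, |f x| ≤ c) :
    |∑ x ∈ s, f x| ≤ M * c := by
  classical
  rw [← Finset.sum_filter_ne_zero]
  have hsub : s.filter (fun x => f x ≠ 0) ⊆ T := fun x hx => by
    rw [Finset.mem_filter] at hx
    exact hs x hx.1 hx.2
  calc |∑ x ∈ s.filter (fun x => f x ≠ 0), f x| ≤ ∑ x ∈ s.filter (fun x => f x ≠ 0), |f x| :=
        Finset.abs_sum_le_sum_abs _ _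
    _ ≤ (s.filter (fun x => f x ≠ 0)).card • c :=
        Finset.sum_le_card_nsmul _ _ _ fun x hx => hf x (Finset.mem_filter.1 hx).1
    _ ≤ M * c := by
        rw [nsmul_eq_mul]
        gcongr
        exact (Finset.card_le_card hsub).trans hT

/-- Small ball estimate for sparse polynomials of degree two in independent Gaussian variables. -/
theorem stdGaussianPi_smallBall_le (hA : ∀ a b, A a b = A b a) (hA1 : ∃ a b, |A a b| = 1)
    {M : ℕ} {T : Finset (Option (Fin d) × Option (Fin d))} (hT : T.card ≤ M)
    (hAT : ∀ a b, A a b ≠ 0 → (a, b) ∈ T) (hu : 0 < u) (hu8 : 8 * u ≤ 1)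
    (hMu : 2 * M * u ≤ 1) :
    stdGaussianPi d {z | (∀ a b, A a b ≠ 0 → |homCoord z a| ≤ 1 / u) ∧
      |quadForm A (homCoord z)| ≤ u ^ 16} ≤ ENNReal.ofReal (4 * u) := by
  have hmono : ENNReal.ofReal (2 * u) ≤ ENNReal.ofReal (4 * u) :=
    ENNReal.ofReal_le_ofReal (by linarith)
  have hne : ∀ {a b : Option (Fin d)} {n : ℕ}, u ^ n ≤ |A a b| → A a b ≠ 0 := fun {a b n} h h0 => by
    rw [h0, abs_zero] at h
    exact absurd h (not_le.2 (pow_pos hu n))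
  have hu1 : u ≤ 1 := by linarith
  -- Four cases: a large diagonal entry, a large mixed entry, a large linear entry, or only the
  -- constant is large. The thresholds `u ^ 8`, `u ^ 8`, `u ^ 4` are spaced so that entries already
  -- excluded are negligible, even when multiplied by coordinates of size `1 / u` and summed over
  -- `M` terms.
  by_cases hdiag : ∃ i : Fin d, u ^ 8 ≤ |A (some i) (some i)|
  · obtain ⟨i, hi⟩ := hdiag
    refine (measure_mono ?_).trans ((stdGaussianPi_diag_le hA hu hu8 hi).trans hmono)
    exact fun z hz => ⟨hz.1 _ _ (hne hi), hz.2⟩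
  by_cases hoff : ∃ i j : Fin d, u ^ 8 ≤ |A (some i) (some j)|
  · obtain ⟨i, j, hij⟩ := hoff
    have hji : j ≠ i := fun h => hdiag ⟨i, by rw [h] at hij; exact hij⟩
    -- Resampling twice: over `z j` the linear coefficient in `z i` is rarely below `u ^ 12`, and
    -- when it is not, the form is rarely small over `z i`.
    have hsub : {z | (∀ a b, A a b ≠ 0 → |homCoord z a| ≤ 1 / u) ∧
        |quadForm A (homCoord z)| ≤ u ^ 16} ⊆
        {z | |z j| ≤ 1 / u ∧ |2 * crossTerm A (some i) (homCoord z)| ≤ u ^ 12} ∪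
        {z | |z i| ≤ 1 / u ∧ u ^ 12 ≤ |2 * crossTerm A (some i) (homCoord z)| ∧
          |quadForm A (homCoord z)| ≤ u ^ 16} := by
      intro z hz
      rcases le_total |2 * crossTerm A (some i) (homCoord z)| (u ^ 12) with h | h
      · exact Or.inl ⟨hz.1 (some j) (some i) (by rw [hA]; exact hne hij), h⟩
      · exact Or.inr ⟨hz.1 (some i) (some j) (hne hij), h, hz.2⟩
    calc _ ≤ _ := measure_mono hsub
      _ ≤ _ := measure_union_le _ _
      _ ≤ ENNReal.ofReal (2 * u) + ENNReal.ofReal (2 * u) :=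
        add_le_add (stdGaussianPi_crossTerm_le hu hu8 hji hij) (stdGaussianPi_cross_le hA hu hu8 i)
      _ = _ := by rw [← ENNReal.ofReal_add (by linarith) (by linarith)]; ring_nf
  simp only [not_exists, not_le] at hoff
  by_cases hlin : ∃ i : Fin d, u ^ 4 ≤ |A (some i) none|
  · obtain ⟨i, hi⟩ := hlin
    refine (measure_mono fun z hz => ?_).trans ((stdGaussianPi_cross_le hA hu hu8 i).trans hmono)
    refine ⟨hz.1 _ _ (hne hi), ?_, hz.2⟩
    rw [crossTerm, ← Finset.add_sum_erase _ _
      (Finset.mem_erase.2 ⟨by simp, Finset.mem_univ (none : Option (Fin d))⟩),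
      homCoord_none, mul_one]
    set s := (Finset.univ.erase (some i)).erase (none : Option (Fin d)) with hs
    classical
    have hsum : |∑ a ∈ s, A (some i) a * homCoord z a| ≤ M * (u ^ 8 * (1 / u)) := by
      refine sum_abs_le_of_sparse (T := T.image Prod.snd) (by positivity)
        (Finset.card_image_le.trans hT) (fun a _ ha => ?_) fun a ha => ?_
      · exact Finset.mem_image.2 ⟨(some i, a), hAT _ _ (left_ne_zero_of_mul ha), rfl⟩
      · rw [abs_mul]
        by_cases h0 : A (some i) a = 0
        · rw [h0]; simp; positivity
        · obtain ⟨j, rfl⟩ : ∃ j, a = some j :=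
            Option.ne_none_iff_exists'.1 (Finset.ne_of_mem_erase ha)
          refine mul_le_mul (hoff i j).le ?_ (abs_nonneg _) (by positivity)
          exact hz.1 _ (some i) (by rw [hA]; exact h0)
    have h7 : (M : ℝ) * (u ^ 8 * (1 / u)) = (2 * M * u) * (u ^ 6 / 2) := by
      field_simp
    have h6 : u ^ 6 ≤ u ^ 4 := pow_le_pow_of_le_one hu.le hu1 (by norm_num)
    have h12 : u ^ 12 ≤ u ^ 4 := pow_le_pow_of_le_one hu.le hu1 (by norm_num)
    have h8 : (2 * M * u) * (u ^ 6 / 2) ≤ 1 * (u ^ 6 / 2) := by gcongr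
    rw [abs_mul, abs_two]
    have := abs_sub_abs_le_abs_add (A (some i) none) (∑ a ∈ s, A (some i) a * homCoord z a)
    linarith
  simp only [not_exists, not_le] at hlin
  have hsmall : ∀ a b, (a, b) ≠ ((none, none) : Option (Fin d) × Option (Fin d)) →
      |A a b| ≤ u ^ 4 := by
    have h84 : u ^ 8 ≤ u ^ 4 := pow_le_pow_of_le_one hu.le hu1 (by norm_num)
    rintro (_ | i) (_ | j) h
    · exact absurd rfl h
    · rw [hA]; exact (hlin j).le
    · exact (hlin i).le
    · exact (hoff i j).le.trans h84
  have hu41 : u ^ 4 < 1 := pow_lt_one₀ hu.le (by linarith) (by norm_num)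
  have hnone : |A none none| = 1 := by
    obtain ⟨a, b, hab⟩ := hA1
    by_cases h : (a, b) = ((none, none) : Option (Fin d) × Option (Fin d))
    · rw [Prod.mk.injEq] at h
      rwa [h.1, h.2] at hab
    · linarith [hsmall a b h]
  -- Here the constant coefficient has modulus 1 and the rest contributes at most `u / 2` on the
  -- box, so the set is empty.
  refine (measure_mono (t := ∅) fun z hz => ?_).trans (by simp)
  exfalso
  have hquad : quadForm A (homCoord z) = A none none +
      ∑ p ∈ (Finset.univ : Finset (Option (Fin d) × Option (Fin d))).erase (none, none),
        A p.1 p.2 * (homCoord z p.1 * homCoord z p.2) := by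
    rw [quadForm, ← Finset.sum_product', Finset.univ_product_univ,
      ← Finset.add_sum_erase _ _ (Finset.mem_univ ((none, none) : Option (Fin d) × Option (Fin d)))]
    simp
  have hsum : |∑ p ∈ (Finset.univ : Finset (Option (Fin d) × Option (Fin d))).erase (none, none),
        A p.1 p.2 * (homCoord z p.1 * homCoord z p.2)| ≤ M * (u ^ 4 * (1 / u * (1 / u))) := by
    refine sum_abs_le_of_sparse (by positivity) hT
      (fun p _ hp => hAT _ _ (left_ne_zero_of_mul hp)) fun p hp => ?_
    rw [abs_mul, abs_mul]
    by_cases h0 : A p.1 p.2 = 0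
    · rw [h0]; simp; positivity
    · have h1 := hz.1 _ _ h0
      have h2 := hz.1 p.2 p.1 (by rw [hA]; exact h0)
      have h3 := hsmall p.1 p.2 (Finset.ne_of_mem_erase hp)
      gcongr
  have h7 : (M : ℝ) * (u ^ 4 * (1 / u * (1 / u))) = (2 * M * u) * (u / 2) := by
    field_simp
  have h8 : (2 * M * u) * (u / 2) ≤ 1 * (u / 2) := by gcongr
  have h16 : u ^ 16 ≤ u := pow_le_of_le_one hu.le hu1 (by norm_num)
  have h9 := abs_sub_abs_le_abs_add (A none none)
    (∑ p ∈ (Finset.univ : Finset (Option (Fin d) × Option (Fin d))).erase (none, none),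
        A p.1 p.2 * (homCoord z p.1 * homCoord z p.2))
  have h10 := hz.2
  rw [hquad] at h10
  linarith

end SmallBall

/-! ### Brackets from rounded coefficients, and their number -/

section Bracketing

variable {d M : ℕ}

theorem stdGaussianPi_lt_abs_homCoord_le (a : Option (Fin d)) {u : ℝ} (hu : 0 < u) (hu1 : u ≤ 1) :
    stdGaussianPi d {z | 1 / u < |homCoord z a|} ≤ ENNReal.ofReal (u ^ 2) := by
  cases a with
  | none =>
    refine (measure_mono (t := ∅) fun z hz => ?_).trans (by simp)
    have h1 : 1 / u < |homCoord z none| := hz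
    rw [homCoord_none, abs_one, div_lt_one hu] at h1
    exact absurd hu1 (not_le.2 h1)
  | some i =>
    have hm : MeasurableSet {s : ℝ | 1 / u < |s|} :=
      measurableSet_lt measurable_const measurable_id.abs
    have h1 : stdGaussianPi d {z | 1 / u < |homCoord z (some i)|} =
        gaussianReal 0 1 {s | 1 / u < |s|} :=
      (measurePreserving_eval (fun _ : Fin d => gaussianReal 0 1) i).measure_preimage
        hm.nullMeasurableSet
    rw [h1]
    have h2 := meas_ge_le_variance_div_sq (memLp_id_gaussianReal (μ := 0) (v := 1) 2)
      (one_div_pos.2 hu)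
    refine (measure_mono fun s hs => ?_).trans (h2.trans (ENNReal.ofReal_le_ofReal ?_))
    · have h3 : 1 / u < |s| := hs
      simpa using h3.le
    · rw [variance_id_gaussianReal]
      simp

/-- The sparse quadratic form in homogeneous coordinates with indices and integer coefficients
`e l`, divided by `G`. -/
noncomputable def gridForm (G : ℕ) (e : Fin M → (Option (Fin d) × Option (Fin d)) × ℤ)
    (z : Fin d → ℝ) : ℝ :=
  ∑ l, ((e l).2 : ℝ) / G * (homCoord z (e l).1.1 * homCoord z (e l).1.2)

/-- The points whose coordinates that occur in `e` are at most `1 / u`. -/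
def gridBox (u : ℝ) (e : Fin M → (Option (Fin d) × Option (Fin d)) × ℤ) : Set (Fin d → ℝ) :=
  {z | ∀ l, |homCoord z (e l).1.1| ≤ 1 / u ∧ |homCoord z (e l).1.2| ≤ 1 / u}

/-- The bracket given by the grid point `e`. -/
def gridBracket (G : ℕ) (u : ℝ) (e : Fin M → (Option (Fin d) × Option (Fin d)) × ℤ) :
    Set (Fin d → ℝ) × Set (Fin d → ℝ) :=
  (gridBox u e ∩ {z | M * (1 / G) * (1 / u) ^ 2 ≤ gridForm G e z},
    (gridBox u e)ᶜ ∪ {z | -(M * (1 / G) * (1 / u) ^ 2) ≤ gridForm G e z})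

theorem measurable_gridForm (G : ℕ) (e : Fin M → (Option (Fin d) × Option (Fin d)) × ℤ) :
    Measurable (gridForm G e) :=
  Finset.measurable_sum _ fun _ _ =>
    ((measurable_homCoord _).mul (measurable_homCoord _)).const_mul _

theorem measurableSet_gridBox (u : ℝ) (e : Fin M → (Option (Fin d) × Option (Fin d)) × ℤ) :
    MeasurableSet (gridBox u e) := by
  have : gridBox u e = ⋂ l, ({z | |homCoord z (e l).1.1| ≤ 1 / u} ∩
      {z | |homCoord z (e l).1.2| ≤ 1 / u}) := by
    ext z; simp [gridBox]
  rw [this]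
  exact MeasurableSet.iInter fun l =>
    (measurableSet_le (measurable_homCoord _).abs measurable_const).inter
      (measurableSet_le (measurable_homCoord _).abs measurable_const)

theorem measurableSet_gridBracket (G : ℕ) (u : ℝ)
    (e : Fin M → (Option (Fin d) × Option (Fin d)) × ℤ) :
    MeasurableSet (gridBracket G u e).1 ∧ MeasurableSet (gridBracket G u e).2 :=
  ⟨(measurableSet_gridBox u e).inter (measurableSet_le measurable_const (measurable_gridForm G e)),
    (measurableSet_gridBox u e).compl.union
      (measurableSet_le measurable_const (measurable_gridForm G e))⟩

theorem stdGaussianPi_compl_gridBox_le {u : ℝ} (hu : 0 < u) (hu1 : u ≤ 1)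
    (e : Fin M → (Option (Fin d) × Option (Fin d)) × ℤ) :
    stdGaussianPi d (gridBox u e)ᶜ ≤ ENNReal.ofReal (2 * M * u ^ 2) := by
  have hsub : (gridBox u e)ᶜ ⊆ ⋃ l, ({z | 1 / u < |homCoord z (e l).1.1|} ∪
      {z | 1 / u < |homCoord z (e l).1.2|}) := by
    intro z hz
    simp only [gridBox, Set.mem_compl_iff, Set.mem_ofPred_eq, not_forall, not_and_or, not_le] at hz
    simpa only [Set.mem_iUnion, Set.mem_union, Set.mem_ofPred_eq] using hz
  calc _ ≤ _ := measure_mono hsub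
    _ ≤ ∑ l, stdGaussianPi d ({z | 1 / u < |homCoord z (e l).1.1|} ∪
      {z | 1 / u < |homCoord z (e l).1.2|}) := measure_iUnion_fintype_le _ _
    _ ≤ ∑ _l : Fin M, ENNReal.ofReal (2 * u ^ 2) := Finset.sum_le_sum fun l _ => by
        refine (measure_union_le _ _).trans ((add_le_add
          (stdGaussianPi_lt_abs_homCoord_le _ hu hu1)
          (stdGaussianPi_lt_abs_homCoord_le _ hu hu1)).trans_eq ?_)
        rw [← ENNReal.ofReal_add (by positivity) (by positivity), two_mul]
    _ = _ := by
        rw [Finset.sum_const, Finset.card_univ, Fintype.card_fin, nsmul_eq_mul,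
          ← ENNReal.ofReal_natCast, ← ENNReal.ofReal_mul (by positivity)]
        ring_nf

/-- A sparse array can be listed with a given number of entries. -/
theorem exists_enumeration_of_sparse {A : Option (Fin d) → Option (Fin d) → ℝ}
    {T : Finset (Option (Fin d) × Option (Fin d))} (hT : T.card ≤ M)
    (hAT : ∀ a b, A a b ≠ 0 → (a, b) ∈ T) (hA1 : ∀ a b, |A a b| ≤ 1) :
    ∃ (idx : Fin M → Option (Fin d) × Option (Fin d)) (c : Fin M → ℝ), (∀ l, |c l| ≤ 1) ∧
      (∀ a b, A a b ≠ 0 → ∃ l, idx l = (a, b)) ∧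
      ∀ w, quadForm A w = ∑ l, c l * (w (idx l).1 * w (idx l).2) := by
  classical
  obtain ⟨g⟩ : Nonempty (T ↪ Fin M) :=
    Function.Embedding.nonempty_of_card_le (by simpa using hT)
  set idx : Fin M → Option (Fin d) × Option (Fin d) :=
    -- Unused slots get coefficient 0 and the constant coordinate 1, which satisfies every box
    -- condition with `u ≤ 1`.
    Function.extend g (fun t => t.1) fun _ => (none, none) with hidx
  set c : Fin M → ℝ := Function.extend g (fun t => A t.1.1 t.1.2) fun _ => 0 with hc
  have hig : ∀ t, idx (g t) = t.1 := fun t => g.injective.extend_apply _ _ t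
  have hcg : ∀ t, c (g t) = A t.1.1 t.1.2 := fun t => g.injective.extend_apply _ _ t
  have hc0 : ∀ l, l ∉ Set.range g → c l = 0 := fun l hl =>
    Function.extend_apply' _ _ _ (by simpa using hl)
  refine ⟨idx, c, fun l => ?_, fun a b hab => ⟨g ⟨(a, b), hAT a b hab⟩, hig _⟩, fun w => ?_⟩
  · by_cases hl : l ∈ Set.range g
    · obtain ⟨t, rfl⟩ := hl
      rw [hcg]
      exact hA1 _ _
    · rw [hc0 l hl]; simp
  · rw [← Fintype.sum_of_injective g g.injective (fun t : T => A t.1.1 t.1.2 * (w t.1.1 * w t.1.2))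
      _ (fun l hl => by rw [hc0 l hl, zero_mul]) (fun t => by rw [hcg, hig])]
    rw [quadForm, ← Finset.sum_product', Finset.univ_product_univ,
      Finset.sum_coe_sort T (fun p => A p.1 p.2 * (w p.1 * w p.2))]
    refine (Finset.sum_subset (Finset.subset_univ T) fun p _ hp => ?_).symm
    rw [not_ne_iff.1 fun h => hp (hAT _ _ h), zero_mul]

/-- The grid brackets of mesh `1 / G` contain brackets of every normalised sparse quadratic form. -/
theorem exists_gridBracket {A : Option (Fin d) → Option (Fin d) → ℝ}
    (hA : ∀ a b, A a b = A b a) (hA1 : ∀ a b, |A a b| ≤ 1) (hAe : ∃ a b, |A a b| = 1)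
    {T : Finset (Option (Fin d) × Option (Fin d))} (hT : T.card ≤ M)
    (hAT : ∀ a b, A a b ≠ 0 → (a, b) ∈ T) {n : ℕ} (hn : 8 ≤ n) (hMn : 2 * M ≤ n) :
    ∃ e : Fin M → (Option (Fin d) × Option (Fin d)) × ℤ,
      (∀ l, (e l).2 ∈ Finset.Icc (-(n ^ 19 : ℕ) : ℤ) (n ^ 19 : ℕ)) ∧
      (gridBracket (n ^ 19) (1 / (n : ℝ)) e).1 ⊆ {z | 0 ≤ quadForm A (homCoord z)} ∧
      {z | 0 ≤ quadForm A (homCoord z)} ⊆ (gridBracket (n ^ 19) (1 / (n : ℝ)) e).2 ∧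
      (stdGaussianPi d).real ((gridBracket (n ^ 19) (1 / (n : ℝ)) e).2 \
        (gridBracket (n ^ 19) (1 / (n : ℝ)) e).1) ≤ 5 / n := by
  obtain ⟨idx, c, hc1, hcov, hquad⟩ := exists_enumeration_of_sparse hT hAT hA1
  have hn0 : (0 : ℝ) < n := by exact_mod_cast (by omega : 0 < n)
  have hn8 : (8 : ℝ) ≤ n := by exact_mod_cast hn
  have hMn' : 2 * (M : ℝ) ≤ n := by exact_mod_cast hMn
  set G : ℕ := n ^ 19 with hG
  have hGR : (G : ℝ) = (n : ℝ) ^ 19 := by rw [hG]; push_cast; rfl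
  have hG0 : (0 : ℝ) < G := by rw [hGR]; positivity
  set u : ℝ := 1 / n with hu
  have hu0 : 0 < u := by positivity
  have hu8 : 8 * u ≤ 1 := by rw [hu, mul_one_div, div_le_one hn0]; exact hn8
  have hMu : 2 * M * u ≤ 1 := by rw [hu, mul_one_div, div_le_one hn0]; exact hMn'
  have hGu : (1 : ℝ) / G = u ^ 19 := by rw [hGR, hu, div_pow, one_pow]
  set e : Fin M → (Option (Fin d) × Option (Fin d)) × ℤ := fun l => (idx l, ⌊c l * G⌋) with he
  have hround : ∀ l, |c l - ((e l).2 : ℝ) / G| ≤ 1 / G := fun l => by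
    have h1 := Int.floor_le (c l * G)
    have h3 := Int.lt_floor_add_one (c l * G)
    have h2 : c l - ((e l).2 : ℝ) / G = (c l * G - ⌊c l * G⌋) / G := by
      rw [he]; field_simp
    rw [h2, abs_div, abs_of_pos hG0]
    gcongr
    rw [abs_le]
    constructor <;> linarith
  have happrox : ∀ z ∈ gridBox u e,
      |quadForm A (homCoord z) - gridForm G e z| ≤ M * (1 / G) * (1 / u) ^ 2 := by
    intro z hz
    rw [hquad, gridForm, ← Finset.sum_sub_distrib]
    refine (Finset.abs_sum_le_sum_abs _ _).trans ?_
    refine (Finset.sum_le_card_nsmul _ _ (1 / G * (1 / u) ^ 2) fun l _ => ?_).trans_eq ?_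
    · have h1 := hz l
      rw [← sub_mul, abs_mul, abs_mul, sq]
      have := hround l
      have h2 := h1.1
      have h3 := h1.2
      gcongr
    · rw [Finset.card_univ, Fintype.card_fin, nsmul_eq_mul, mul_assoc]
  set w : ℝ := M * (1 / G) * (1 / u) ^ 2 with hw
  -- This fixes the grid exponent 19: 16 for the small ball level, 2 for products of two coordinates
  -- of size `1 / u`, and 1 to absorb `2 * M ≤ n`.
  have hw2 : 2 * w ≤ u ^ 16 := by
    have : 2 * w = (2 * M * u) * u ^ 16 := by
      rw [hw, hGu]; field_simp
    rw [this]
    exact mul_le_of_le_one_left (by positivity) hMu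
  refine ⟨e, fun l => ?_, ?_, ?_, ?_⟩
  · have h1 := abs_le.1 (hc1 l)
    have h2 : |⌊c l * G⌋| ≤ (G : ℤ) := by
      rw [abs_le]
      constructor
      · exact Int.le_floor.2 (by push_cast; nlinarith)
      · have h3 : ((⌊c l * G⌋ : ℤ) : ℝ) ≤ ((G : ℤ) : ℝ) :=
          (Int.floor_le _).trans (by push_cast; nlinarith)
        exact_mod_cast h3
    exact Finset.mem_Icc.2 (abs_le.1 h2)
  · rintro z ⟨hz, hzw⟩
    have h1 := abs_le.1 (happrox z hz)
    have h2 : w ≤ gridForm G e z := hzw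
    show 0 ≤ quadForm A (homCoord z)
    linarith
  · intro z hz
    by_cases hzb : z ∈ gridBox u e
    · have h1 := abs_le.1 (happrox z hzb)
      have h2 : 0 ≤ quadForm A (homCoord z) := hz
      refine Or.inr ?_
      show -w ≤ gridForm G e z
      linarith
    · exact Or.inl hzb
  · have hsub : (gridBracket G u e).2 \ (gridBracket G u e).1 ⊆ (gridBox u e)ᶜ ∪
        {z | (∀ a b, A a b ≠ 0 → |homCoord z a| ≤ 1 / u) ∧ |quadForm A (homCoord z)| ≤ u ^ 16} := by
      rintro z ⟨hz2, hz1⟩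
      by_cases hzb : z ∈ gridBox u e
      · refine Or.inr ⟨fun a b hab => ?_, ?_⟩
        · obtain ⟨l, hl⟩ := hcov a b hab
          have h1 : |homCoord z (idx l).1| ≤ 1 / u := (hzb l).1
          rwa [hl] at h1
        · have h1 := abs_le.1 (happrox z hzb)
          have h2 : -w ≤ gridForm G e z := hz2.resolve_left fun h => h hzb
          have h3 : gridForm G e z < w := by
            by_contra h
            exact hz1 ⟨hzb, not_lt.1 h⟩
          rw [abs_le]
          constructor <;> linarith
      · exact Or.inl hzb
    refine ENNReal.toReal_le_of_le_ofReal (by positivity) ?_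
    calc _ ≤ _ := measure_mono hsub
      _ ≤ _ := measure_union_le _ _
      _ ≤ ENNReal.ofReal (2 * M * u ^ 2) + ENNReal.ofReal (4 * u) :=
        add_le_add (stdGaussianPi_compl_gridBox_le hu0 (by linarith) e)
          (stdGaussianPi_smallBall_le hA hAe hT hAT hu0 hu8 hMu)
      _ ≤ ENNReal.ofReal (5 / n) := by
        rw [← ENNReal.ofReal_add (by positivity) (by positivity)]
        refine ENNReal.ofReal_le_ofReal ?_
        have : (5 : ℝ) / n = 5 * u := by rw [hu]; ring
        rw [this]
        nlinarith

/-- The positivity regions of quadratic polynomials with at most `M` coefficients. -/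
def sparseQuadRegions (d M : ℕ) : Set (Set (Fin d → ℝ)) :=
  {S | ∃ A : Option (Fin d) → Option (Fin d) → ℝ, (∀ a b, A a b = A b a) ∧
    (∃ T : Finset (Option (Fin d) × Option (Fin d)), T.card ≤ M ∧
      ∀ a b, A a b ≠ 0 → (a, b) ∈ T) ∧ S = {z | 0 ≤ quadForm A (homCoord z)}}

/-- The grid of integer coefficient lists. -/
noncomputable def coeffGrid (d M G : ℕ) : Finset (Fin M → (Option (Fin d) × Option (Fin d)) × ℤ) :=
  Fintype.piFinset fun _ => Finset.univ ×ˢ Finset.Icc (-(G : ℤ)) G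

theorem card_coeffGrid (d M G : ℕ) :
    (coeffGrid d M G).card = ((d + 1) ^ 2 * (2 * G + 1)) ^ M := by
  rw [coeffGrid, Fintype.card_piFinset]
  simp only [Finset.card_product, Finset.card_univ, Fintype.card_prod, Fintype.card_option,
    Fintype.card_fin, Int.card_Icc, Finset.prod_const]
  congr 2
  · ring
  · omega

open Classical in
/-- Brackets of size `2⁻ʲ` for the regions of sparse quadratic polynomials. -/
noncomputable def sparseBrackets (d M : ℕ) : ℕ → Finset (Set (Fin d → ℝ) × Set (Fin d → ℝ))
  | 0 => {(∅, Set.univ)}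
  | j + 1 => (insert (Set.univ, Set.univ) ((coeffGrid d M ((64 * M * 2 ^ (j + 1)) ^ 19)).image
      (gridBracket ((64 * M * 2 ^ (j + 1)) ^ 19) (1 / ((64 * M * 2 ^ (j + 1) : ℕ) : ℝ))))).filter
        fun b => (stdGaussianPi d).real (b.2 \ b.1) ≤ (1 / 2) ^ (j + 1)

theorem measurableSet_of_mem_sparseBrackets (j : ℕ) :
    ∀ b ∈ sparseBrackets d M j, MeasurableSet b.1 ∧ MeasurableSet b.2 := by
  classical
  intro b hb
  cases j with
  | zero =>
    rw [sparseBrackets, Finset.mem_singleton] at hb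
    rw [hb]
    exact ⟨MeasurableSet.empty, MeasurableSet.univ⟩
  | succ j =>
    rw [sparseBrackets, Finset.mem_filter, Finset.mem_insert, Finset.mem_image] at hb
    obtain ⟨rfl | ⟨e, -, rfl⟩, -⟩ := hb
    · exact ⟨MeasurableSet.univ, MeasurableSet.univ⟩
    · exact measurableSet_gridBracket _ _ e

theorem measureReal_diff_le_of_mem_sparseBrackets (j : ℕ) :
    ∀ b ∈ sparseBrackets d M j, (stdGaussianPi d).real (b.2 \ b.1) ≤ (1 / 2) ^ j := by
  classical
  intro b hb
  cases j with
  | zero => exact measureReal_le_one.trans (by simp)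
  | succ j => exact (Finset.mem_filter.1 hb).2

/-- Each of `M` slots chooses a pair of indices and an integer, so the dimension enters only through
`log (d + 1)`. The crude `M ≤ exp M` produces the term `M²`, that is `k⁴`, which the target can
afford. -/
theorem card_sparseBrackets_le (hM : 1 ≤ M) (j : ℕ) :
    ((sparseBrackets d M j).card : ℝ) ≤
      Real.exp (M * (2 * Real.log (d + 1) + 200 * M) * (j + 1)) := by
  classical
  have hM1 : (1 : ℝ) ≤ M := by exact_mod_cast hM
  have hlog : 0 ≤ Real.log ((d : ℝ) + 1) :=
    Real.log_nonneg (by linarith [Nat.cast_nonneg (α := ℝ) d])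
  cases j with
  | zero =>
    rw [sparseBrackets, Finset.card_singleton, Nat.cast_one]
    exact Real.one_le_exp (by positivity)
  | succ j =>
    set n : ℕ := 64 * M * 2 ^ (j + 1) with hn
    have hn1 : 1 ≤ n := by
      rw [hn]; exact Nat.one_le_iff_ne_zero.2 (by positivity)
    have hcard : (sparseBrackets d M (j + 1)).card ≤ ((d + 1) ^ 2 * (2 * n ^ 19 + 1)) ^ M + 1 := by
      rw [sparseBrackets, ← card_coeffGrid]
      exact (Finset.card_filter_le _ _).trans ((Finset.card_insert_le _ _).trans
        (Nat.add_le_add_right Finset.card_image_le _))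
    have hpos : 1 ≤ ((d + 1) ^ 2 * (3 * n ^ 19)) ^ M := Nat.one_le_iff_ne_zero.2 (by positivity)
    have hcard2 : (sparseBrackets d M (j + 1)).card ≤ 2 * ((d + 1) ^ 2 * (3 * n ^ 19)) ^ M := by
      have h1 : ((d + 1) ^ 2 * (2 * n ^ 19 + 1)) ^ M ≤ ((d + 1) ^ 2 * (3 * n ^ 19)) ^ M := by
        have : 1 ≤ n ^ 19 := Nat.one_le_pow _ _ hn1
        gcongr
        omega
      omega
    have hcard3 : ((sparseBrackets d M (j + 1)).card : ℝ) ≤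
        2 * (((d : ℝ) + 1) ^ 2 * (3 * (n : ℝ) ^ 19)) ^ M := by exact_mod_cast hcard2
    have he2 : (2 : ℝ) ≤ Real.exp 1 := by linarith [Real.add_one_le_exp (1 : ℝ)]
    have he3 : (3 : ℝ) ≤ Real.exp 2 := by linarith [Real.add_one_le_exp (2 : ℝ)]
    have hed : (d : ℝ) + 1 = Real.exp (Real.log (d + 1)) := by
      rw [Real.exp_log (by positivity)]
    have h2pow : ∀ i : ℕ, (2 : ℝ) ^ i ≤ Real.exp i := fun i => by
      calc (2 : ℝ) ^ i ≤ Real.exp 1 ^ i := pow_le_pow_left₀ (by norm_num) he2 i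
        _ = Real.exp i := by rw [← Real.exp_nat_mul, mul_one]
    have hen : (n : ℝ) ≤ Real.exp (6 + M + (j + 1)) := by
      rw [hn, Real.exp_add, Real.exp_add]
      push_cast
      have h1 : (64 : ℝ) ≤ Real.exp 6 := by
        simpa using (by norm_num : (64 : ℝ) = 2 ^ 6).le.trans (h2pow 6)
      have h2 : (M : ℝ) ≤ Real.exp M := by linarith [Real.add_one_le_exp (M : ℝ)]
      have h3 : (2 : ℝ) ^ (j + 1) ≤ Real.exp (j + 1) := by simpa using h2pow (j + 1)
      gcongr
    refine hcard3.trans ?_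
    calc 2 * (((d : ℝ) + 1) ^ 2 * (3 * (n : ℝ) ^ 19)) ^ M
        ≤ Real.exp 1 * (Real.exp (Real.log (d + 1)) ^ 2 *
            (Real.exp 2 * Real.exp (6 + M + (j + 1)) ^ 19)) ^ M := by
          rw [← hed]
          gcongr
      _ = Real.exp (1 + M * (2 * Real.log (d + 1) + (2 + 19 * (6 + M + (j + 1))))) := by
          rw [← Real.exp_nat_mul, ← Real.exp_nat_mul, ← Real.exp_add, ← Real.exp_add,
            ← Real.exp_nat_mul, ← Real.exp_add]
          norm_num
      _ ≤ _ := by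
          refine Real.exp_le_exp.2 ?_
          push_cast
          have hj : (0 : ℝ) ≤ j := Nat.cast_nonneg j
          have h1 : 0 ≤ (M : ℝ) * Real.log (d + 1) * (j + 1) := by positivity
          have h2 : (M : ℝ) ≤ M * M := le_mul_of_one_le_left (by linarith) hM1
          have h3 : (M : ℝ) * j ≤ M * M * j := by gcongr
          nlinarith

theorem exists_mem_sparseBrackets (hM : 1 ≤ M) :
    ∀ S ∈ sparseQuadRegions d M, ∀ j, ∃ b ∈ sparseBrackets d M j, b.1 ⊆ S ∧ S ⊆ b.2 := by
  classical
  rintro S ⟨A, hA, ⟨T, hT, hAT⟩, rfl⟩ j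
  cases j with
  | zero =>
    exact ⟨(∅, Set.univ), by rw [sparseBrackets, Finset.mem_singleton], Set.empty_subset _,
      Set.subset_univ _⟩
  | succ j =>
    -- The zero form cannot be normalised; its region is the whole space, hence the extra bracket
    -- `(univ, univ)`.
    by_cases hA0 : ∀ a b, A a b = 0
    · refine ⟨(Set.univ, Set.univ), ?_, fun z _ => ?_, Set.subset_univ _⟩
      · rw [sparseBrackets, Finset.mem_filter]
        refine ⟨Finset.mem_insert_self _ _, ?_⟩
        rw [Set.sdiff_self, measureReal_empty]
        positivity
      · simp [quadForm, hA0]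
    · simp only [not_forall] at hA0
      obtain ⟨a₀, b₀, h₀⟩ := hA0
      obtain ⟨p, -, hp⟩ := Finset.exists_max_image
        (Finset.univ : Finset (Option (Fin d) × Option (Fin d))) (fun p => |A p.1 p.2|)
        ⟨(a₀, b₀), Finset.mem_univ _⟩
      set m := |A p.1 p.2| with hm
      have hm0 : 0 < m := (abs_pos.2 h₀).trans_le (hp (a₀, b₀) (Finset.mem_univ _))
      have habs : ∀ a b, |A a b / m| = |A a b| / m := fun a b => by
        rw [abs_div, abs_of_pos hm0]
      have hform : ∀ w, quadForm (fun a b => A a b / m) w = quadForm A w / m := fun w => by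
        simp only [quadForm, Finset.sum_div, div_mul_eq_mul_div]
      have hset : {z : Fin d → ℝ | 0 ≤ quadForm A (homCoord z)} =
          {z | 0 ≤ quadForm (fun a b => A a b / m) (homCoord z)} := by
        ext z
        simp only [Set.mem_ofPred_eq, hform]
        exact ⟨fun h => div_nonneg h hm0.le, fun h => by simpa [hm0.ne'] using mul_nonneg h hm0.le⟩
      have hpow2 : 1 ≤ 2 ^ (j + 1) := Nat.one_le_two_pow
      have hn64 : 64 * M ≤ 64 * M * 2 ^ (j + 1) := Nat.le_mul_of_pos_right _ hpow2
      obtain ⟨e, he, h1, h2, h3⟩ := exists_gridBracket (A := fun a b => A a b / m)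
        (fun a b => by rw [hA a b]) (fun a b => by
          rw [habs, div_le_one hm0]; exact hp (a, b) (Finset.mem_univ _))
        ⟨p.1, p.2, by rw [habs, div_self hm0.ne']⟩ hT
        (fun a b hab => hAT a b fun h => hab (by rw [h, zero_div]))
        -- This choice gives `8 ≤ n`, `2 * M ≤ n` and `5 / n ≤ (1 / 2) ^ (j + 1)`.
        (n := 64 * M * 2 ^ (j + 1)) (by omega) (by omega)
      rw [hset]
      refine ⟨_, ?_, h1, h2⟩
      rw [sparseBrackets, Finset.mem_filter]
      refine ⟨Finset.mem_insert_of_mem (Finset.mem_image.2 ⟨e, ?_, rfl⟩), h3.trans ?_⟩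
      · exact Fintype.mem_piFinset.2 fun l => Finset.mem_product.2 ⟨Finset.mem_univ _, he l⟩
      · have hM1 : (1 : ℝ) ≤ M := by exact_mod_cast hM
        push_cast
        rw [div_pow, one_pow, div_le_div_iff₀ (by positivity) (by positivity)]
        have : (0 : ℝ) < 2 ^ (j + 1) := by positivity
        nlinarith

end Bracketing

/-! ### From sparse polynomials under `N(μ, I)` to sparse forms under the standard Gaussian -/

section Reduction

namespace SparsePoly

variable {d k : ℕ}

theorem measurePreserving_gaussianId (μ : EuclideanSpace ℝ (Fin d)) :
    MeasurePreserving (fun z : Fin d → ℝ => μ + WithLp.toLp 2 z) (stdGaussianPi d)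
      (gaussianId μ) := by
  refine ⟨by fun_prop, ?_⟩
  have h : (fun z : Fin d → ℝ => μ + WithLp.toLp 2 z) =
      (fun x : EuclideanSpace ℝ (Fin d) => μ + x) ∘ WithLp.toLp 2 := rfl
  rw [h, ← Measure.map_map (by fun_prop) (by fun_prop), map_pi_eq_stdGaussian, gaussianId,
    multivariateGaussian]
  simp

theorem measurePreserving_sub_gaussianId (μ : EuclideanSpace ℝ (Fin d)) :
    MeasurePreserving (fun x : EuclideanSpace ℝ (Fin d) => WithLp.ofLp (x - μ)) (gaussianId μ)
      (stdGaussianPi d) := by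
  refine ⟨by fun_prop, ?_⟩
  rw [← (measurePreserving_gaussianId μ).map_eq, Measure.map_map (by fun_prop) (by fun_prop)]
  convert Measure.map_id
  ext z i
  simp

/-- Only `He₀ = 1`, `He₁ = X` and `He₂ = X² - 1` occur, the last exactly when the two indices
coincide. -/
theorem prod_hermite_multiplicity (I : Fin 2 → Fin d) (x : Fin d → ℝ) :
    ∏ j, Polynomial.aeval (x j) (Polynomial.hermite (multiplicity I j)) =
      x (I 0) * x (I 1) - if I 0 = I 1 then 1 else 0 := by
  have hmul : ∀ j, multiplicity I j = (if I 0 = j then 1 else 0) + if I 1 = j then 1 else 0 := by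
    intro j
    rw [multiplicity, Finset.card_filter, Fin.sum_univ_two]
  by_cases h : I 0 = I 1
  · rw [Finset.prod_eq_single (I 0)]
    · rw [hmul, if_pos rfl, if_pos h.symm, if_pos h, ← h, one_add_one_eq_two,
        show Polynomial.hermite 2 = Polynomial.X ^ 2 - 1 by
          rw [Polynomial.hermite_succ, Polynomial.hermite_one]
          simp [sq]]
      simp [sq]
    · intro j _ hj
      rw [hmul, if_neg hj.symm, if_neg (by rw [← h]; exact hj.symm)]
      simp
    · simp
  · rw [Finset.prod_eq_mul (I 0) (I 1) h]
    · rw [hmul, hmul, if_pos rfl, if_neg (Ne.symm h), if_neg h, if_pos rfl, if_neg h]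
      simp
    · rintro j - ⟨h0, h1⟩
      rw [hmul, if_neg h0.symm, if_neg h1.symm]
      simp
    · simp
    · simp

theorem harmonicPoly_two (A : Matrix (Fin d) (Fin d) ℝ) (x : EuclideanSpace ℝ (Fin d)) :
    harmonicPoly (l := 2) (fun I => A (I 0) (I 1)) x =
      (Real.sqrt 2)⁻¹ * (∑ i, ∑ j, A i j * (x i * x j) - ∑ i, A i i) := by
  rw [harmonicPoly]
  congr 1
  have h1 : ∀ I : Fin 2 → Fin d, A (I 0) (I 1) *
      ∏ j, Polynomial.aeval (x j) (Polynomial.hermite (multiplicity I j)) =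
      A (I 0) (I 1) * (x (I 0) * x (I 1) - if I 0 = I 1 then 1 else 0) := fun I => by
    rw [prod_hermite_multiplicity I (fun j => x j)]
  have h2 : ∑ I : Fin 2 → Fin d, A (I 0) (I 1) *
      (x (I 0) * x (I 1) - if I 0 = I 1 then 1 else 0) =
      ∑ p : Fin d × Fin d, A p.1 p.2 * (x p.1 * x p.2 - if p.1 = p.2 then 1 else 0) :=
    Fintype.sum_equiv (finTwoArrowEquiv (Fin d)) _ _ fun I => rfl
  refine (Fintype.sum_congr _ _ h1).trans (h2.trans ?_)
  rw [Fintype.sum_prod_type]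
  simp [mul_sub, Finset.sum_sub_distrib]

/-- Translation affects only the constant term. Symmetry splits each `v i` into two halves, giving
at most `2k² + 1 ≤ 4k²` entries. -/
theorem mem_sparseQuadRegions_of_linear (hk : 1 ≤ k) (μ v : EuclideanSpace ℝ (Fin d))
    (hv : {i | v i ≠ 0}.ncard ≤ k ^ 2) :
    {z : Fin d → ℝ | 0 ≤ ∑ i, v i * (μ i + z i)} ∈ sparseQuadRegions d (4 * k ^ 2) := by
  classical
  have hk2 : 1 ≤ k ^ 2 := Nat.one_le_pow _ _ hk
  rw [Set.ncard_eq_toFinset_card'] at hv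
  set V := {i | v i ≠ 0}.toFinset with hV
  have hmem : ∀ {i}, v i ≠ 0 → i ∈ V := fun {i} h => by rw [hV]; simpa using h
  refine ⟨fun a b => a.elim (b.elim (∑ i, v i * μ i) fun i => v i / 2)
    fun i => b.elim (v i / 2) fun _ => 0, ?_, ⟨insert (none, none)
      (V.image (fun i => (some i, none)) ∪ V.image (fun i => (none, some i))), ?_, ?_⟩, ?_⟩
  · rintro (_ | i) (_ | j) <;> rfl
  · have h1 := Finset.card_insert_le ((none, none) : Option (Fin d) × Option (Fin d))
      (V.image (fun i => (some i, none)) ∪ V.image (fun i => (none, some i)))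
    have h2 := Finset.card_union_le
      (V.image fun i => ((some i, none) : Option (Fin d) × Option (Fin d)))
      (V.image (fun i => (none, some i)))
    have h3 := Finset.card_image_le (s := V)
      (f := fun i => ((some i, none) : Option (Fin d) × Option (Fin d)))
    have h4 := Finset.card_image_le (s := V)
      (f := fun i => ((none, some i) : Option (Fin d) × Option (Fin d)))
    omega
  · rintro (_ | i) (_ | j) h
    · simp
    · have : v j ≠ 0 := fun h0 => h (by simp [h0])
      simp [hmem this]
    · have : v i ≠ 0 := fun h0 => h (by simp [h0])
      simp [hmem this]
    · exact absurd rfl h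
  · ext z
    simp only [Set.mem_ofPred_eq, quadForm, Fintype.sum_option, Option.elim_none,
      Option.elim_some, homCoord_none, homCoord_some]
    have : ∑ i, v i * (μ i + z i) = (∑ i, v i * μ i) * (1 * 1) + ∑ i, v i / 2 * (1 * z i) +
        ∑ i, (v i / 2 * (z i * 1) + ∑ j, 0 * (z i * z j)) := by
      rw [mul_one, mul_one, add_assoc, ← Finset.sum_add_distrib, ← Finset.sum_add_distrib]
      refine Finset.sum_congr rfl fun i _ => ?_
      simp
      ring
    rw [this]

/-- Translation creates linear coefficients `∑ j, A i j * μ j`, but only for nonzero rows of `A`, of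
which there are at most `k²`. However dense `μ` is, at most `3k² + 1 ≤ 4k²` entries arise. -/
theorem mem_sparseQuadRegions_of_quadratic (hk : 1 ≤ k) (μ : EuclideanSpace ℝ (Fin d))
    {A : Matrix (Fin d) (Fin d) ℝ} (hA : A.IsSymm)
    (hAk : {ij : Fin d × Fin d | A ij.1 ij.2 ≠ 0}.ncard ≤ k ^ 2) :
    {z : Fin d → ℝ | 0 ≤ ∑ i, ∑ j, A i j * ((μ i + z i) * (μ j + z j)) - ∑ i, A i i} ∈
      sparseQuadRegions d (4 * k ^ 2) := by
  classical
  have hk2 : 1 ≤ k ^ 2 := Nat.one_le_pow _ _ hk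
  rw [Set.ncard_eq_toFinset_card'] at hAk
  set V := {ij : Fin d × Fin d | A ij.1 ij.2 ≠ 0}.toFinset with hV
  have hmem : ∀ {i j}, A i j ≠ 0 → (i, j) ∈ V := fun {i j} h => by rw [hV]; simpa using h
  have hrow : ∀ {i}, ∑ j, A i j * μ j ≠ 0 → ∃ j, (i, j) ∈ V := fun {i} h => by
    obtain ⟨j, -, hj⟩ := Finset.exists_ne_zero_of_sum_ne_zero h
    exact ⟨j, hmem (left_ne_zero_of_mul hj)⟩
  refine ⟨fun a b => a.elim
    (b.elim (∑ i, ∑ j, A i j * (μ i * μ j) - ∑ i, A i i) fun i => ∑ j, A i j * μ j)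
    fun i => b.elim (∑ j, A i j * μ j) fun j => A i j, ?_, ⟨insert (none, none)
      (V.image (fun p => (some p.1, none)) ∪ V.image (fun p => (none, some p.1)) ∪
        V.image (fun p => (some p.1, some p.2))), ?_, ?_⟩, ?_⟩
  · rintro (_ | i) (_ | j)
    · rfl
    · rfl
    · rfl
    · exact hA.apply j i
  · have h1 := Finset.card_insert_le ((none, none) : Option (Fin d) × Option (Fin d))
      (V.image (fun p => (some p.1, none)) ∪ V.image (fun p => (none, some p.1)) ∪
        V.image (fun p => (some p.1, some p.2)))
    have h2 := Finset.card_union_le (V.image (fun p => (some p.1, none)) ∪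
      V.image (fun p => ((none, some p.1) : Option (Fin d) × Option (Fin d))))
        (V.image (fun p => (some p.1, some p.2)))
    have h2' := Finset.card_union_le (V.image (fun p => (some p.1, none)))
      (V.image (fun p => ((none, some p.1) : Option (Fin d) × Option (Fin d))))
    have h3 := Finset.card_image_le (s := V)
      (f := fun p => ((some p.1, none) : Option (Fin d) × Option (Fin d)))
    have h4 := Finset.card_image_le (s := V)
      (f := fun p => ((none, some p.1) : Option (Fin d) × Option (Fin d)))
    have h5 := Finset.card_image_le (s := V)
      (f := fun p => ((some p.1, some p.2) : Option (Fin d) × Option (Fin d)))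
    omega
  · rintro (_ | i) (_ | j) h
    · simp
    · obtain ⟨l, hl⟩ := hrow h
      simp only [Finset.mem_insert, Finset.mem_union, Finset.mem_image]
      exact Or.inr (Or.inl (Or.inr ⟨_, hl, rfl⟩))
    · obtain ⟨l, hl⟩ := hrow h
      simp only [Finset.mem_insert, Finset.mem_union, Finset.mem_image]
      exact Or.inr (Or.inl (Or.inl ⟨_, hl, rfl⟩))
    · simp only [Finset.mem_insert, Finset.mem_union, Finset.mem_image]
      exact Or.inr (Or.inr ⟨_, hmem h, rfl⟩)
  · ext z
    simp only [Set.mem_ofPred_eq, quadForm, Fintype.sum_option, Option.elim_none,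
      Option.elim_some, homCoord_none, homCoord_some]
    have hswap : ∑ i, ∑ j, A i j * (μ i * z j) = ∑ i, ∑ j, A i j * (z i * μ j) := by
      rw [Finset.sum_comm]
      refine Finset.sum_congr rfl fun i _ => Finset.sum_congr rfl fun j _ => ?_
      rw [hA.apply i j]
      ring
    have hexp : ∑ i, ∑ j, A i j * ((μ i + z i) * (μ j + z j)) =
        ∑ i, ∑ j, A i j * (μ i * μ j) + ∑ i, ∑ j, A i j * (μ i * z j) +
          ∑ i, ∑ j, A i j * (z i * μ j) + ∑ i, ∑ j, A i j * (z i * z j) := by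
      simp only [← Finset.sum_add_distrib]
      refine Finset.sum_congr rfl fun i _ => Finset.sum_congr rfl fun j _ => ?_
      ring
    have hl : ∀ i, (∑ j, A i j * μ j) * z i = ∑ j, A i j * (z i * μ j) := fun i => by
      rw [Finset.sum_mul]
      exact Finset.sum_congr rfl fun j _ => by ring
    rw [hexp, hswap]
    simp only [one_mul, mul_one, hl, Finset.sum_add_distrib]
    constructor <;> intro h <;> linarith

theorem mem_sparseQuadRegions_of_isSparsePoly (hk : 1 ≤ k) (μ : EuclideanSpace ℝ (Fin d))
    {p : EuclideanSpace ℝ (Fin d) → ℝ} (hp : IsSparsePoly k p) :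
    {z : Fin d → ℝ | 0 ≤ p (μ + WithLp.toLp 2 z)} ∈ sparseQuadRegions d (4 * k ^ 2) := by
  rcases hp with ⟨v, hv, hp⟩ | ⟨A, hA, hAk, hp⟩
  · convert mem_sparseQuadRegions_of_linear hk μ v hv using 4 with z
    simp [hp]
  · convert mem_sparseQuadRegions_of_quadratic hk μ hA hAk using 3 with z
    rw [hp, harmonicPoly_two]
    simp only [PiLp.add_apply]
    constructor
    · intro h
      exact (mul_nonneg_iff_of_pos_left (by positivity)).1 h
    · intro h
      positivity

end SparsePoly

end Reduction

/-! ### Parameters and conclusion -/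

namespace SparsePoly

theorem logFactor_ne_zero {d k : ℕ} {α τ : ℝ} (hd : 1 ≤ d) (hk : 1 ≤ k) (hα : 0 < α) (hτ : 0 < τ)
    (hτ1 : τ < 1) (hne : (d : ℝ) * k / α * Real.log (1 / τ) ≠ 1) : logFactor d k α τ ≠ 0 := by
  have hd' : (0 : ℝ) < d := by exact_mod_cast hd
  have hk' : (0 : ℝ) < k := by exact_mod_cast hk
  have hlog : 0 < Real.log (1 / τ) := Real.log_pos (by rw [lt_div_iff₀ hτ]; linarith)
  have hpos : 0 < (d : ℝ) * k / α * Real.log (1 / τ) := by positivity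
  exact Real.log_ne_zero_of_pos_of_ne_one hpos hne

/-- The entropy of the brackets in terms of `log (d / τ)`. -/
theorem entropy_add_log_le {d k : ℕ} {τ : ℝ} (hd : 1 ≤ d) (hk : 1 ≤ k) (hτ : 0 < τ) (hτ1 : τ < 1)
    (hτd : τ ≤ (d : ℝ) / 2) :
    ((4 * k ^ 2 : ℕ) : ℝ) * (2 * Real.log (d + 1) + 200 * ((4 * k ^ 2 : ℕ) : ℝ)) +
      Real.log (1 / τ) ≤ 6417 * ((k : ℝ) ^ 4 * Real.log (d / τ)) := by
  have hd' : (1 : ℝ) ≤ d := by exact_mod_cast hd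
  have hk' : (1 : ℝ) ≤ k := by exact_mod_cast hk
  have hd0 : (0 : ℝ) < d := by linarith
  set Λ := Real.log (d / τ) with hΛ
  -- The condition `τ ≤ d / 2` keeps `log (d / τ)` away from 0, so that absolute constants can be
  -- absorbed into it.
  have h2 : Real.log 2 ≤ Λ :=
    Real.log_le_log two_pos (by rw [le_div_iff₀ hτ]; linarith)
  have hdΛ : Real.log d ≤ Λ :=
    Real.log_le_log hd0 (by rw [le_div_iff₀ hτ]; nlinarith)
  have hτΛ : Real.log (1 / τ) ≤ Λ :=
    Real.log_le_log (by positivity) (by gcongr)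
  have hd1 : Real.log (d + 1) ≤ 2 * Λ := by
    have h3 : Real.log ((d : ℝ) + 1) ≤ Real.log (2 * d) :=
      Real.log_le_log (by linarith) (by linarith)
    rw [Real.log_mul two_ne_zero hd0.ne'] at h3
    linarith
  have hΛ1 : 1 ≤ 2 * Λ := by linarith [Real.log_two_gt_d9]
  have hΛ0 : 0 ≤ Λ := by linarith
  have hk2 : (1 : ℝ) ≤ (k : ℝ) ^ 2 := one_le_pow₀ hk'
  have hk4 : (k : ℝ) ^ 4 = (k : ℝ) ^ 2 * (k : ℝ) ^ 2 := by ring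
  push_cast
  rw [hk4]
  generalize (k : ℝ) ^ 2 = m at hk2
  have hm2 : m ≤ m * m := le_mul_of_one_le_left (by linarith) hk2
  calc 4 * m * (2 * Real.log (d + 1) + 200 * (4 * m)) + Real.log (1 / τ)
      = 8 * (m * Real.log (d + 1)) + 3200 * (m * m * 1) + Real.log (1 / τ) := by ring
    -- The constant is `6417 = 16 + 6400 + 1`.
    _ ≤ 8 * (m * m * (2 * Λ)) + 3200 * (m * m * (2 * Λ)) + m * m * Λ := by
        have h4 : m * Real.log (d + 1) ≤ m * m * (2 * Λ) :=
          mul_le_mul hm2 hd1 (Real.log_nonneg (by linarith)) (by positivity)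
        have h5 : m * m * 1 ≤ m * m * (2 * Λ) := by gcongr
        have h6 : Λ ≤ m * m * Λ := le_mul_of_one_le_left hΛ0 (by linarith)
        linarith
    _ = _ := by ring

theorem empiricalProb_eq_empFreq {d N : ℕ} (S : Fin N → EuclideanSpace ℝ (Fin d))
    (μ : EuclideanSpace ℝ (Fin d)) (p : EuclideanSpace ℝ (Fin d) → ℝ) :
    empiricalProb S p = empFreq (fun i => WithLp.ofLp (S i - μ))
      {z : Fin d → ℝ | 0 ≤ p (μ + WithLp.toLp 2 z)} := by
  rw [empFreq_eq_ncard_div, empiricalProb]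
  congr 3
  ext i
  simp only [Set.mem_ofPred_eq, WithLp.toLp_ofLp, add_sub_cancel]

theorem measurable_of_isSparsePoly {d k : ℕ} {p : EuclideanSpace ℝ (Fin d) → ℝ}
    (hp : IsSparsePoly k p) : Measurable p := by
  rcases hp with ⟨v, -, hp⟩ | ⟨A, -, -, hp⟩
  · rw [funext hp]
    fun_prop
  · have : p = fun x => (Real.sqrt 2)⁻¹ * (∑ i, ∑ j, A i j * (x i * x j) - ∑ i, A i i) := by
      ext x
      rw [hp, harmonicPoly_two]
    rw [this]
    fun_prop

theorem real_gaussianId_eq {d k : ℕ} (μ : EuclideanSpace ℝ (Fin d))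
    {p : EuclideanSpace ℝ (Fin d) → ℝ} (hp : IsSparsePoly k p) :
    (gaussianId μ).real {x | 0 ≤ p x} =
      (stdGaussianPi d).real {z | 0 ≤ p (μ + WithLp.toLp 2 z)} := by
  have hm : MeasurableSet {x | 0 ≤ p x} :=
    measurableSet_le measurable_const (measurable_of_isSparsePoly hp)
  exact ((measurePreserving_gaussianId μ).measureReal_preimage hm.nullMeasurableSet).symm

end SparsePoly

open SparsePoly in
theorem exists_representative_event {d k N : ℕ} {α τ : ℝ} {μ : EuclideanSpace ℝ (Fin d)}
    (hd : 1 ≤ d) (hk : 1 ≤ k) (hα : 0 < α) (hτ : 0 < τ) (hτ1 : τ < 1)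
    (hτd : τ ≤ (d : ℝ) / 2) (hne : (d : ℝ) * k / α * Real.log (1 / τ) ≠ 1)
    (hN : 196608 * 6417 * 10000 * ((α ^ 6)⁻¹ * (k : ℝ) ^ 12 * Real.log ((d : ℝ) / τ) *
      logFactor d k α τ ^ 4) ≤ (N : ℝ))
    {Ω : Type*} [MeasurableSpace Ω] {P : Measure Ω} [IsProbabilityMeasure P]
    {X : Fin N → Ω → EuclideanSpace ℝ (Fin d)} (hX : ∀ i, HasLaw (X i) (gaussianId μ) P)
    (hind : iIndepFun X P) :
    ∃ E : Set Ω, MeasurableSet E ∧ 1 - τ ≤ P.real E ∧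
      ∀ ω ∈ E, IsRepresentative k α τ μ (fun i => X i ω) := by
  have hL := logFactor_ne_zero hd hk hα hτ hτ1 hne
  have hk0 : (0 : ℝ) < k := by exact_mod_cast hk
  set L := logFactor d k α τ with hLdef
  set ε := α ^ 3 / (100 * (k : ℝ) ^ 4 * L ^ 2) with hε
  -- This needs `L ≠ 0`: division by zero would make the tolerance 0.
  have hε0 : 0 < ε := by positivity
  have hrep : ∀ S : Fin N → EuclideanSpace ℝ (Fin d),
      (∀ A ∈ sparseQuadRegions d (4 * k ^ 2),
        |empFreq (fun i => WithLp.ofLp (S i - μ)) A - (stdGaussianPi d).real A| ≤ ε) →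
      IsRepresentative k α τ μ S := by
    intro S hS p hp
    rw [real_gaussianId_eq μ hp, empiricalProb_eq_empFreq S μ, abs_sub_comm]
    exact hS _ (mem_sparseQuadRegions_of_isSparsePoly hk μ hp)
  by_cases hε1 : ε ≤ 1
  · set M := 4 * k ^ 2 with hM
    have hM1 : 1 ≤ M := by have := Nat.one_le_pow 2 k hk; omega
    have hM1' : (1 : ℝ) ≤ M := by exact_mod_cast hM1
    have hlogd : 0 ≤ Real.log ((d : ℝ) + 1) :=
      Real.log_nonneg (by linarith [Nat.cast_nonneg (α := ℝ) d])
    have hZ : ∀ i, HasLaw (fun ω => WithLp.ofLp (X i ω - μ)) (stdGaussianPi d) P := fun i =>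
      (measurePreserving_sub_gaussianId μ).fun_comp_hasLaw (hX i)
    have hZind : iIndepFun (fun i ω => WithLp.ofLp (X i ω - μ)) P :=
      hind.comp (fun _ x => WithLp.ofLp (x - μ)) fun _ =>
        (measurePreserving_sub_gaussianId μ).measurable
    have hNε : 196608 * ((M : ℝ) * (2 * Real.log (d + 1) + 200 * M) + Real.log (1 / τ)) / ε ^ 2 ≤
        N := by
      have h1 := entropy_add_log_le hd hk hτ hτ1 hτd
      refine le_trans ?_ hN
      calc _ ≤ 196608 * (6417 * ((k : ℝ) ^ 4 * Real.log (d / τ))) / ε ^ 2 := by gcongr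
        _ = _ := by
          rw [hε]
          field_simp
          ring
    have hbad := measureReal_exists_lt_abs_empFreq_sub_le hZ hZind
      (B := sparseBrackets d M) (𝒜 := sparseQuadRegions d M) (by nlinarith) (by rw [sparseBrackets])
      measurableSet_of_mem_sparseBrackets measureReal_diff_le_of_mem_sparseBrackets
      (card_sparseBrackets_le hM1) (exists_mem_sparseBrackets hM1) hε0 hε1 hτ hτ1 hNε
    set bad := {ω | ∃ A ∈ sparseQuadRegions d M,
      ε < |empFreq (fun i => WithLp.ofLp (X i ω - μ)) A - (stdGaussianPi d).real A|} with hbaddef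
    -- The bad event is a union over uncountably many regions, so it is replaced by a measurable
    -- hull of the same probability.
    refine ⟨(toMeasurable P bad)ᶜ, (measurableSet_toMeasurable P bad).compl, ?_, fun ω hω => ?_⟩
    · rw [probReal_compl_eq_one_sub (measurableSet_toMeasurable P bad), measureReal_def,
        measure_toMeasurable, ← measureReal_def]
      linarith
    · refine hrep _ fun A hA => ?_
      by_contra hlt
      exact hω (subset_toMeasurable P bad ⟨A, hA, not_le.1 hlt⟩)
  -- If `ε > 1`, as happens for `L` close to 0, every sample is representative because both
  -- quantities lie in `[0, 1]`.
  · refine ⟨Set.univ, MeasurableSet.univ, by simp [hτ.le], fun ω _ => hrep _ fun A _ => ?_⟩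
    have h1 := empFreq_nonneg (fun i => WithLp.ofLp (X i ω - μ)) A
    have h2 := empFreq_le_one (fun i => WithLp.ofLp (X i ω - μ)) A
    have h3 := measureReal_nonneg (μ := stdGaussianPi d) (s := A)
    have h4 := measureReal_le_one (μ := stdGaussianPi d) (s := A)
    rw [abs_le]
    constructor <;> linarith

theorem mainTheorem4 :
    ∃ C : ℝ, 0 < C ∧
      ∀ (d k N : ℕ) (α τ : ℝ) (μ : EuclideanSpace ℝ (Fin d)),
        1 ≤ d → 1 ≤ k → 0 < α → α ≤ 1 / 2 → 0 < τ → τ < 1 → τ ≤ (d : ℝ) / 2 →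
        (d : ℝ) * k / α * Real.log (1 / τ) ≠ 1 →
        C * ((α ^ 6)⁻¹ * (k : ℝ) ^ 12 * Real.log ((d : ℝ) / τ) *
          SparsePoly.logFactor d k α τ ^ 4) ≤ (N : ℝ) →
        ∀ (Ω : Type*) [MeasurableSpace Ω] (P : Measure Ω) [IsProbabilityMeasure P]
          (X : Fin N → Ω → EuclideanSpace ℝ (Fin d)),
          (∀ i, HasLaw (X i) (SparsePoly.gaussianId μ) P) →
          iIndepFun X P →
          ∃ E : Set Ω, MeasurableSet E ∧ 1 - τ ≤ P.real E ∧
            ∀ ω ∈ E, SparsePoly.IsRepresentative k α τ μ (fun i => X i ω) := by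

  -- The factors come from chaining, from the entropy bound, and from squaring the 100 in the
  -- tolerance.
  refine ⟨196608 * 6417 * 10000, by norm_num, ?_⟩
  intro d k N α τ μ hd hk hα _ hτ hτ1 hτd hne hN Ω _ P _ X hX hind
  exact exists_representative_event hd hk hα hτ hτ1 hτd hne hN hX hind
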